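/- **Corollary (high-dimensional case, $\ell^p$ semi-norms).** Let $d,n\ge 1$ be integers, $1\le p<\infty$, $\tilde d=\binom{n+d-1}{d-1}$. Let $B$ be the open unit ball of $\mathbf C^d$ (Euclidean norm $|\cdot|$, inner product $\langle z,w\rangle=\sum_j z_j\overline{w_j}$) and $v$ Lebesgue measure normalized by $v(B)=1$. For $\sigma>-1$ put $\lambda=d+1+\sigma$ and let $$T_\sigma G(z)=c_\sigma\int_B\frac{(1-|w|^2)^\sigma}{(1-\langle z,w\rangle)^{\lambda}}\,G(w)\,dv(w),\qquad z\in B,$$ be the Bergman projection, where the power is the principal branch and $c_\sigma$ is chosen so that $c_\sigma\int_B(1-|w|^2)^\sigma\,dv(w)=1$. Let the Bloch space $\mathcal B$ consist of all $f$ analytic in $B$ with $\sup_{z\in B}(1-|z|^2)|\nabla f(z)|<\infty$, where $\nabla f=(\partial f/\partial z_1,\dots,\partial f/\partial z_d)$, and give it the semi-norm $$\|f\|_{\mathcal B}=\sup_{z\in B}(1-|z|^2)^n\Big(\sum_{|\alpha|=n}|\partial^\alpha f(z)|^p\Big)^{1/p},$$ the sum being over all multi-indices $\alpha\in\mathbf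 Z_{\ge0}^d$ with $|\alpha|=n$. Set $$C_p=\max_{|\zeta|=1}\Big(\sum_{|\alpha|=n}|\zeta^\alpha|^p\Big)^{1/p}.$$ Then for every $\sigma>-1$ the integral defining $T_\sigma G$ converges absolutely on $B$ and $T_\sigma G\in\mathcal B$ for every $G\in L^\infty(B)$, and $$\|T_\sigma\|_{L^\infty(B)\to\mathcal B}:=\sup_{\|G\|_\infty\le1}\|T_\sigma G\|_{\mathcal B}=C_p\,\frac{\Gamma(\lambda+n)\,\Gamma(n)}{\Gamma^2\big((\lambda+n)/2\big)}.$$ Moreover $C_p=1$ if $p\ge 2$, while $$\tilde d^{\,1/p}d^{-n/2}\le C_p\le\tilde d^{\,1/p-1/2}\qquad\text{if }1\le p<2.$$ In particular, for $n=1$, $C_p=d^{1/p-1/2}$ if $1\le p<2$ and $C_p=1$ if $p\ge2$. -/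

import Mathlib

open MeasureTheory
open scoped ENNReal

noncomputable section

namespace BergmanBloch

/-- The space `ℂ^d` with its Hermitian norm `|z|`. -/
abbrev Cd (d : ℕ) : Type := EuclideanSpace ℂ (Fin d)

/-- The open unit ball `B` of `ℂ^d`. -/
abbrev unitBall (d : ℕ) : Set (Cd d) := Metric.ball 0 1

/-- Lebesgue measure `dv` on the unit ball, normalized so that `v(B) = 1`. -/
def ballMeasure (d : ℕ) : Measure (Cd d) :=
  (volume (unitBall d))⁻¹ • volume.restrict (unitBall d)

/-- The kernel `K_σ(z,w) = (1-|w|²)^σ / (1-⟨z,w⟩)^(d+1+σ)`, with the principal branch of the power.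
In Mathlib `inner ℂ w z = ∑ j, z j * conj (w j)`, which is `⟨z,w⟩`. -/
def bergmanKernel (d : ℕ) (σ : ℝ) (z w : Cd d) : ℂ :=
  (((1 - ‖w‖ ^ 2) ^ σ : ℝ) : ℂ) / (1 - inner ℂ w z) ^ (((d : ℝ) + 1 + σ : ℝ) : ℂ)

/-- The constant `c_σ` which makes `c_σ (1-|w|²)^σ dv(w)` a probability measure on the ball. -/
def bergmanConst (d : ℕ) (σ : ℝ) : ℝ :=
  (∫ w, (1 - ‖w‖ ^ 2) ^ σ ∂(ballMeasure d))⁻¹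

/-- The Bergman projection `T_σ G(z) = c_σ ∫_B K_σ(z,w) G(w) dv(w)`. -/
def bergmanProj (d : ℕ) (σ : ℝ) (G : Cd d → ℂ) (z : Cd d) : ℂ :=
  (bergmanConst d σ : ℂ) * ∫ w, bergmanKernel d σ z w * G w ∂(ballMeasure d)

/-- The complex partial derivative `∂f/∂z_j`. -/
def partialDeriv {d : ℕ} (j : Fin d) (f : Cd d → ℂ) (z : Cd d) : ℂ :=
  lineDeriv ℂ f z (EuclideanSpace.single j 1)

/-- The mixed derivative `∂^α f = ∂_1^{α_1} ⋯ ∂_d^{α_d} f`. -/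
def mixedPartial {d : ℕ} (α : Fin d → ℕ) (f : Cd d → ℂ) : Cd d → ℂ :=
  (List.finRange d).foldr (fun j g => (partialDeriv j)^[α j] g) f

/-- The multi-indices `α` in `d` variables with `|α| = n`. -/
def multiIndices (d n : ℕ) : Finset (Fin d → ℕ) := Finset.univ.piAntidiag n

/-- The `ℓ^p` norm `|Z|_p` of a vector `Z` indexed by the multi-indices of order `n`. -/
def ellp (d n : ℕ) (p : ℝ) (Z : (Fin d → ℕ) → ℂ) : ℝ :=
  (∑ α ∈ multiIndices d n, ‖Z α‖ ^ p) ^ (1 / p)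

/-- The vector `Z(ζ)` of all monomials `ζ^α`. -/
def monomials {d : ℕ} (ζ : Cd d) (α : Fin d → ℕ) : ℂ := ∏ j, ζ j ^ α j

/-- The semi-norm `sup_{z ∈ B} (1-|z|²)^n (∑_{|α|=n} |∂^α f(z)|^p)^{1/p}`, as a supremum in
`[0,∞]`. -/
def blochSeminorm (d n : ℕ) (p : ℝ) (f : Cd d → ℂ) : ℝ≥0∞ :=
  ⨆ z ∈ unitBall d,
    ENNReal.ofReal ((1 - ‖z‖ ^ 2) ^ n * ellp d n p (fun α => mixedPartial α f z))

/-- The Bloch space: `f` is holomorphic in `B` and `sup_{z ∈ B} (1-|z|²) |∇f(z)| < ∞`. -/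
def MemBloch (d : ℕ) (f : Cd d → ℂ) : Prop :=
  DifferentiableOn ℂ f (unitBall d) ∧
    ∃ M : ℝ, ∀ z ∈ unitBall d,
      (1 - ‖z‖ ^ 2) * Real.sqrt (∑ j, ‖partialDeriv j f z‖ ^ 2) ≤ M

/-- The norm of `T_σ` from `L^∞(B)` to the Bloch space: the supremum, in `[0,∞]`, of the semi-norm
of `T_σ G` over all measurable `G` with `‖G‖_∞ ≤ 1`. -/
def bergmanOpNorm (d n : ℕ) (p σ : ℝ) : ℝ≥0∞ :=
  ⨆ (G : Cd d → ℂ) (_ : MemLp G ∞ (ballMeasure d)) (_ : eLpNorm G ∞ (ballMeasure d) ≤ 1),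
    blochSeminorm d n p (bergmanProj d σ G)

end BergmanBloch

end

noncomputable section

namespace BergmanBloch

/-! Write `l = d + 1 + σ` and let `μ` be the probability measure `bergmanMeasure d σ`.
Differentiating under the integral sign, `∂^α T_σ G(z)` is `rising l n` times the `μ`-integral of
`conj(w^α) G(w) (1-⟨z,w⟩)^(-(l+n))`. Minkowski's inequality in `ℓ^p` and the homogeneity of the
monomials bound the `ℓ^p` norm of these derivatives by `C_p * rising l n * ∫ |1-⟨z,w⟩|^(-(l+n)) dμ`
when `|G| ≤ 1`.

The remaining integral is computed exactly. With `a = (l+n)/2` its integrand is `|(1-⟨z,w⟩)^(-a)|²`;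
powers of `⟨z,w⟩` of different degree are orthogonal under `μ`, so the binomial series gives `₂F₁(a,
a; l; |z|²)` (`integral_kernel_rpow`). The Taylor coefficients of this function, divided by those of
`(1-x)^(-n)`, increase to `Γ(l)Γ(n)/Γ(a)²` (`coeffRatio_monotone`, `tendsto_coeffRatio`). Hence
`(1-x)^n ₂F₁` stays below that limit and tends to it as `x → 1`. Since `rising l n = Γ(l+n)/Γ(l)`,
the upper bound is the asserted constant.

For sharpness take `z = rζ` with `|ζ| = 1` maximizing the `ℓ^p` norm of the monomials, and let `G`
be the unimodular phase that makes the kernel positive. As `r → 1` the kernel concentrates at `ζ`,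
so `conj(w^α)` may be replaced by `conj(ζ^α)`. The error is controlled by `|w-ζ| ≤
2|1-⟨z,w⟩|^(1/2)`, which lowers the order of the singularity by one half
(`norm_integral_kernel_sub_le`). -/

/-! ### Multi-indices, the `ℓ^p` norm of the monomials, and the constant `C_p`. -/

lemma mem_multiIndices {d n : ℕ} {α : Fin d → ℕ} : α ∈ multiIndices d n ↔ ∑ j, α j = n := by
  simp [multiIndices]

lemma card_multiIndices {d : ℕ} (hd : 1 ≤ d) (n : ℕ) :
    (multiIndices d n).card = (n + d - 1).choose (d - 1) := by
  rw [multiIndices, ← Finset.map_sym_eq_piAntidiag, Finset.card_map, Finset.sym_univ,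
    Finset.card_univ, Sym.card_sym_eq_choose, Fintype.card_fin, add_comm d n,
    ← Nat.choose_symm_of_eq_add]
  omega

lemma ellp_eq_norm (d n : ℕ) {p : ℝ} (hp : 1 ≤ p) (Z : (Fin d → ℕ) → ℂ) :
    ellp d n p Z =
      ‖WithLp.toLp (ENNReal.ofReal p) (fun α : multiIndices d n => Z α)‖ := by
  have h : (ENNReal.ofReal p).toReal = p := ENNReal.toReal_ofReal (by linarith)
  rw [PiLp.norm_eq_sum (by rw [h]; linarith), h, ellp,
    ← Finset.sum_coe_sort (multiIndices d n) (fun α => ‖Z α‖ ^ p)]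

lemma ellp_nonneg (d n : ℕ) (p : ℝ) (Z : (Fin d → ℕ) → ℂ) : 0 ≤ ellp d n p Z :=
  Real.rpow_nonneg (Finset.sum_nonneg fun _ _ => Real.rpow_nonneg (norm_nonneg _) _) _

lemma ellp_congr {d n : ℕ} {p : ℝ} {Z W : (Fin d → ℕ) → ℂ}
    (h : ∀ α ∈ multiIndices d n, ‖Z α‖ = ‖W α‖) : ellp d n p Z = ellp d n p W := by
  unfold ellp
  congr 1
  exact Finset.sum_congr rfl fun α hα => by rw [h α hα]

lemma ellp_mono {d n : ℕ} {p : ℝ} (hp : 1 ≤ p) {Z W : (Fin d → ℕ) → ℂ}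
    (h : ∀ α ∈ multiIndices d n, ‖Z α‖ ≤ ‖W α‖) : ellp d n p Z ≤ ellp d n p W := by
  unfold ellp
  refine Real.rpow_le_rpow (Finset.sum_nonneg fun _ _ => Real.rpow_nonneg (norm_nonneg _) _)
    (Finset.sum_le_sum fun α hα => Real.rpow_le_rpow (norm_nonneg _) (h α hα) (by linarith))
    (by positivity)

lemma ellp_mul_left {d n : ℕ} {p : ℝ} (hp : 1 ≤ p) (c : ℂ) (Z : (Fin d → ℕ) → ℂ) :
    ellp d n p (fun α => c * Z α) = ‖c‖ * ellp d n p Z := by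
  unfold ellp
  have : ∑ α ∈ multiIndices d n, ‖c * Z α‖ ^ p
      = ‖c‖ ^ p * ∑ α ∈ multiIndices d n, ‖Z α‖ ^ p := by
    rw [Finset.mul_sum]
    exact Finset.sum_congr rfl fun α _ => by
      rw [norm_mul, Real.mul_rpow (norm_nonneg _) (norm_nonneg _)]
  rw [this, Real.mul_rpow (by positivity)
    (Finset.sum_nonneg fun _ _ => Real.rpow_nonneg (norm_nonneg _) _),
    ← Real.rpow_mul (norm_nonneg _), mul_one_div_cancel (by linarith), Real.rpow_one]

lemma norm_apply_le_ellp {d n : ℕ} {p : ℝ} (hp : 1 ≤ p) (Z : (Fin d → ℕ) → ℂ)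
    {α : Fin d → ℕ} (hα : α ∈ multiIndices d n) : ‖Z α‖ ≤ ellp d n p Z := by
  unfold ellp
  have h1 : ‖Z α‖ ^ p ≤ ∑ α ∈ multiIndices d n, ‖Z α‖ ^ p :=
    Finset.single_le_sum (f := fun α => ‖Z α‖ ^ p)
      (fun _ _ => Real.rpow_nonneg (norm_nonneg _) _) hα
  calc ‖Z α‖ = (‖Z α‖ ^ p) ^ (1 / p) := by
        rw [← Real.rpow_mul (norm_nonneg _), mul_one_div_cancel (by linarith), Real.rpow_one]
    _ ≤ _ := Real.rpow_le_rpow (by positivity) h1 (by positivity)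

lemma continuous_monomials {d : ℕ} (α : Fin d → ℕ) :
    Continuous fun ζ : Cd d => monomials ζ α := by
  unfold monomials
  fun_prop

lemma continuous_ellp_monomials (d n : ℕ) {p : ℝ} (hp : 1 ≤ p) :
    Continuous fun ζ : Cd d => ellp d n p (monomials ζ) := by
  unfold ellp
  refine Continuous.rpow_const (continuous_finsetSum _ fun α _ => ?_)
    fun _ => Or.inr (by positivity)
  exact ((continuous_monomials α).norm).rpow_const fun _ => Or.inr (by linarith)

lemma monomials_smul {d n : ℕ} (c : ℂ) (ζ : Cd d) {α : Fin d → ℕ} (hα : α ∈ multiIndices d n) :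
    monomials (c • ζ) α = c ^ n * monomials ζ α := by
  simp only [monomials, PiLp.smul_apply, smul_eq_mul, mul_pow, Finset.prod_mul_distrib,
    Finset.prod_pow_eq_pow_sum, mem_multiIndices.1 hα]

lemma ellp_monomials_smul {d n : ℕ} {p : ℝ} (hp : 1 ≤ p) (c : ℂ) (ζ : Cd d) :
    ellp d n p (monomials (c • ζ)) = ‖c‖ ^ n * ellp d n p (monomials ζ) := by
  rw [← norm_pow, ← ellp_mul_left hp]
  exact ellp_congr fun α hα => by rw [monomials_smul c ζ hα]

lemma norm_monomials_le_one {d : ℕ} {ζ : Cd d} (hζ : ‖ζ‖ ≤ 1) (α : Fin d → ℕ) :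
    ‖monomials ζ α‖ ≤ 1 := by
  rw [monomials, norm_prod]
  refine Finset.prod_le_one (fun _ _ => norm_nonneg _) fun j _ => ?_
  rw [norm_pow]
  exact pow_le_one₀ (norm_nonneg _) ((PiLp.norm_apply_le ζ j).trans hζ)

/-- The multinomial expansion of `(∑ |ζ_i|²)^n` consists of these terms with coefficients at least
1. -/
lemma sum_norm_monomials_sq_le {d : ℕ} (n : ℕ) (ζ : Cd d) :
    ∑ α ∈ multiIndices d n, ‖monomials ζ α‖ ^ 2 ≤ (‖ζ‖ ^ 2) ^ n := by
  rw [EuclideanSpace.norm_sq_eq, Finset.sum_pow_eq_sum_piAntidiag]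
  refine Finset.sum_le_sum fun α _ => ?_
  have h : ‖monomials ζ α‖ ^ 2 = ∏ i, (‖ζ i‖ ^ 2) ^ α i := by
    rw [monomials, norm_prod, ← Finset.prod_pow]
    exact Finset.prod_congr rfl fun i _ => by rw [norm_pow, ← pow_mul, ← pow_mul, mul_comm]
  rw [h]
  refine le_mul_of_one_le_left (Finset.prod_nonneg fun _ _ => by positivity) ?_
  exact_mod_cast Nat.multinomial_pos _ _

lemma exists_isGreatest_ellp_monomials {d : ℕ} (hd : 1 ≤ d) (n : ℕ) {p : ℝ} (hp : 1 ≤ p) :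
    ∃ C : ℝ, IsGreatest ((fun ζ : Cd d => ellp d n p (monomials ζ)) '' Metric.sphere 0 1) C := by
  have : Nonempty (Fin d) := ⟨⟨0, hd⟩⟩
  refine ((isCompact_sphere (0 : Cd d) 1).image
    (continuous_ellp_monomials d n hp)).exists_isGreatest (Set.Nonempty.image _ ?_)
  exact ⟨EuclideanSpace.single ⟨0, hd⟩ 1, by simp⟩

/-- Homogeneity of degree `n` carries the bound from the sphere to the closed ball; `1 ≤ n` makes
the vector vanish at the origin. -/
lemma ellp_monomials_le {d n : ℕ} (hn : 1 ≤ n) {p : ℝ} (hp : 1 ≤ p) {C : ℝ}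
    (hC : IsGreatest ((fun ζ : Cd d => ellp d n p (monomials ζ)) '' Metric.sphere 0 1) C)
    {w : Cd d} (hw : ‖w‖ ≤ 1) : ellp d n p (monomials w) ≤ C := by
  have hC0 : 0 ≤ C := by
    obtain ⟨ζ, _, rfl⟩ := hC.1
    exact ellp_nonneg _ _ _ _
  rcases eq_or_ne w 0 with rfl | h0
  · have : (0 : Cd d) = (0 : ℂ) • (0 : Cd d) := by simp
    rw [this, ellp_monomials_smul hp]
    simpa [show n ≠ 0 by omega] using hC0
  · have hw0 : ‖w‖ ≠ 0 := norm_ne_zero_iff.2 h0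
    have h : w = (‖w‖ : ℂ) • (((‖w‖ : ℂ)⁻¹) • w) := by
      rw [smul_smul, mul_inv_cancel₀ (by exact_mod_cast hw0), one_smul]
    rw [h, ellp_monomials_smul hp]
    have h1 : ellp d n p (monomials (((‖w‖ : ℂ)⁻¹) • w)) ≤ C :=
      hC.2 ⟨_, by simp [norm_smul, hw0], rfl⟩
    calc _ ≤ 1 * C := by
          refine mul_le_mul (pow_le_one₀ (norm_nonneg _) ?_) h1 (ellp_nonneg _ _ _ _) zero_le_one
          simpa using hw
      _ = C := one_mul C

/-- Since `|ζ^α| ≤ 1`, lowering the exponent from `p` to 2 only increases the sum, which is then at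
most 1. A coordinate vector attains 1. -/
lemma isGreatest_eq_one_of_two_le {d n : ℕ} (hd : 1 ≤ d) {p : ℝ} (hp : 2 ≤ p) {C : ℝ}
    (hC : IsGreatest ((fun ζ : Cd d => ellp d n p (monomials ζ)) '' Metric.sphere 0 1) C) :
    C = 1 := by
  apply le_antisymm
  · obtain ⟨ζ, hζ, rfl⟩ := hC.1
    rw [mem_sphere_zero_iff_norm] at hζ
    refine Real.rpow_le_one (Finset.sum_nonneg fun _ _ => Real.rpow_nonneg (norm_nonneg _) _) ?_
      (by positivity)
    calc ∑ α ∈ multiIndices d n, ‖monomials ζ α‖ ^ p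
        ≤ ∑ α ∈ multiIndices d n, ‖monomials ζ α‖ ^ 2 := by
          refine Finset.sum_le_sum fun α _ => ?_
          rw [← Real.rpow_natCast]
          exact Real.rpow_le_rpow_of_exponent_ge_of_imp (norm_nonneg _)
            (norm_monomials_le_one hζ.le α) (by simpa using hp) (by intro _ h; linarith)
      _ ≤ 1 := by simpa [hζ] using sum_norm_monomials_sq_le n ζ
  · let i : Fin d := ⟨0, hd⟩
    refine le_trans ?_ (hC.2 ⟨EuclideanSpace.single i 1, by simp, rfl⟩)
    refine le_trans ?_ (norm_apply_le_ellp (by linarith) _ (α := Pi.single i n)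
      (by simp [mem_multiIndices]))
    have : monomials (EuclideanSpace.single i (1 : ℂ)) (Pi.single i n) = 1 := by
      refine Finset.prod_eq_one fun j _ => ?_
      by_cases h : j = i
      · subst h; simp
      · simp [h]
    rw [this, norm_one]

/-- The power mean inequality with exponent `2 / p ≥ 1`, applied to the numbers `‖Z α‖ ^ p`. -/
lemma ellp_le_card_rpow_mul (d n : ℕ) {p : ℝ} (hp : 1 ≤ p) (hp2 : p < 2)
    (Z : (Fin d → ℕ) → ℂ) :
    ellp d n p Z ≤ ((multiIndices d n).card : ℝ) ^ (1 / p - 1 / 2) *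
      (∑ α ∈ multiIndices d n, ‖Z α‖ ^ 2) ^ (1 / 2 : ℝ) := by
  have hp0 : 0 < p := by linarith
  set S := ∑ α ∈ multiIndices d n, ‖Z α‖ ^ p
  have hS : 0 ≤ S := Finset.sum_nonneg fun _ _ => Real.rpow_nonneg (norm_nonneg _) _
  have h := Real.rpow_sum_le_const_mul_sum_rpow_of_nonneg (multiIndices d n)
    (f := fun α => ‖Z α‖ ^ p) (p := 2 / p) ((one_le_div hp0).2 hp2.le)
    (fun _ _ => Real.rpow_nonneg (norm_nonneg _) _)
  have h2 : ∑ α ∈ multiIndices d n, (‖Z α‖ ^ p) ^ (2 / p)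
      = ∑ α ∈ multiIndices d n, ‖Z α‖ ^ 2 := by
    refine Finset.sum_congr rfl fun α _ => ?_
    rw [← Real.rpow_mul (norm_nonneg _), mul_div_cancel₀ _ hp0.ne', ← Real.rpow_natCast]
    norm_num
  rw [h2] at h
  have h3 := Real.rpow_le_rpow (z := 1 / 2) (Real.rpow_nonneg hS _) h (by norm_num)
  rw [← Real.rpow_mul hS, Real.mul_rpow (by positivity)
    (Finset.sum_nonneg fun _ _ => by positivity), ← Real.rpow_mul (by positivity)] at h3
  convert! h3 using 2
  · rw [show 2 / p * (1 / 2) = 1 / p by field_simp]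
    rfl
  · congr 1
    field_simp

lemma isGreatest_le_of_lt_two {d n : ℕ} (hd : 1 ≤ d) {p : ℝ} (hp : 1 ≤ p) (hp2 : p < 2) {C : ℝ}
    (hC : IsGreatest ((fun ζ : Cd d => ellp d n p (monomials ζ)) '' Metric.sphere 0 1) C) :
    C ≤ (((n + d - 1).choose (d - 1) : ℕ) : ℝ) ^ (1 / p - 1 / 2) := by
  obtain ⟨ζ, hζ, rfl⟩ := hC.1
  rw [mem_sphere_zero_iff_norm] at hζ
  refine (ellp_le_card_rpow_mul d n hp hp2 _).trans ?_
  rw [card_multiIndices hd]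
  refine mul_le_of_le_one_right (by positivity) ?_
  refine Real.rpow_le_one (Finset.sum_nonneg fun _ _ => by positivity) ?_ (by norm_num)
  simpa [hζ] using sum_norm_monomials_sq_le n ζ

/-- At the unit vector with all coordinates `d^(-1/2)`, every monomial of degree `n` has modulus
`d^(-n/2)`. -/
lemma le_isGreatest {d n : ℕ} (hd : 1 ≤ d) {p : ℝ} (hp : 1 ≤ p) {C : ℝ}
    (hC : IsGreatest ((fun ζ : Cd d => ellp d n p (monomials ζ)) '' Metric.sphere 0 1) C) :
    (((n + d - 1).choose (d - 1) : ℕ) : ℝ) ^ (1 / p) * (d : ℝ) ^ (-(n : ℝ) / 2) ≤ C := by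
  have hd0 : (0 : ℝ) < d := by exact_mod_cast hd
  let s : ℝ := (d : ℝ) ^ (-(1 : ℝ) / 2)
  have hs : 0 < s := by positivity
  let ζ : Cd d := WithLp.toLp 2 fun _ => (s : ℂ)
  have hζ : ‖ζ‖ = 1 := by
    have : ‖ζ‖ ^ 2 = 1 := by
      rw [EuclideanSpace.norm_sq_eq]
      simp only [ζ, Complex.norm_real, Real.norm_eq_abs, sq_abs, Finset.sum_const,
        Finset.card_univ, Fintype.card_fin, nsmul_eq_mul]
      rw [show s ^ 2 = (d : ℝ)⁻¹ by
        simp only [s]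
        rw [← Real.rpow_natCast, ← Real.rpow_mul hd0.le, ← Real.rpow_neg_one]
        norm_num]
      exact mul_inv_cancel₀ hd0.ne'
    nlinarith [norm_nonneg ζ]
  refine le_trans (le_of_eq ?_) (hC.2 ⟨ζ, by simpa using hζ, rfl⟩)
  have h1 : ∀ α ∈ multiIndices d n, ‖monomials ζ α‖ ^ p = (s ^ n) ^ p := by
    intro α hα
    simp [monomials, ζ, Finset.prod_pow_eq_pow_sum, mem_multiIndices.1 hα, abs_of_pos hs]
  simp only [ellp]
  rw [Finset.sum_congr rfl h1, Finset.sum_const, nsmul_eq_mul, card_multiIndices hd,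
    Real.mul_rpow (by positivity) (by positivity), ← Real.rpow_mul (by positivity),
    mul_one_div_cancel (by linarith), Real.rpow_one]
  congr 1
  simp only [s]
  rw [← Real.rpow_natCast, ← Real.rpow_mul hd0.le]
  congr 1
  ring

/-- For `n = 1` there are exactly `d` multi-indices, and the general lower and upper bounds
coincide. -/
lemma isGreatest_eq_of_order_one {d n : ℕ} (hd : 1 ≤ d) {p : ℝ} (hp : 1 ≤ p) (hn : n = 1)
    (hp2 : p < 2) {C : ℝ}
    (hC : IsGreatest ((fun ζ : Cd d => ellp d n p (monomials ζ)) '' Metric.sphere 0 1) C) :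
    C = (d : ℝ) ^ (1 / p - 1 / 2) := by
  have hd0 : (0 : ℝ) < d := by exact_mod_cast hd
  have h1 := isGreatest_le_of_lt_two hd hp hp2 hC
  have h2 := le_isGreatest hd hp hC
  have h3 : (n + d - 1).choose (d - 1) = d := by
    subst hn
    obtain ⟨e, rfl⟩ : ∃ e, d = e + 1 := ⟨d - 1, by omega⟩
    simp [show 1 + (e + 1) - 1 = e + 1 by omega]
  rw [h3] at h1 h2
  refine le_antisymm h1 (le_trans (le_of_eq ?_) h2)
  rw [← Real.rpow_add hd0, hn]
  congr 1
  push_cast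
  ring

/-! ### Binomial series and the comparison of `₂F₁(a, a; l; x)` with `(1-x)^(-t)`. -/

section

open Filter Topology Nat

/-- The rising factorial `(s)_k = s (s + 1) ⋯ (s + k - 1)`. -/
def rising (s : ℝ) (k : ℕ) : ℝ := ∏ j ∈ Finset.range k, (s + j)

lemma rising_zero (s : ℝ) : rising s 0 = 1 := by simp [rising]

lemma rising_succ (s : ℝ) (k : ℕ) : rising s (k + 1) = rising s k * (s + k) :=
  Finset.prod_range_succ _ _

lemma rising_pos {s : ℝ} (hs : 0 < s) (k : ℕ) : 0 < rising s k :=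
  Finset.prod_pos fun _ _ => by positivity

lemma Gamma_add_natCast {s : ℝ} (hs : 0 < s) (k : ℕ) :
    Real.Gamma (s + k) = rising s k * Real.Gamma s := by
  induction k with
  | zero => simp [rising_zero]
  | succ k ih =>
    rw [Nat.cast_succ, ← add_assoc, Real.Gamma_add_one (by positivity), ih, rising_succ]
    ring

lemma factorial_mul_choose (s : ℝ) (k : ℕ) :
    (k ! : ℝ) * Ring.choose (s + k - 1) k = rising s k := by
  have h := Ring.factorial_nsmul_multichoose_eq_ascPochhammer s k
  rw [Ring.choose, show s + k - 1 - k + 1 = s by ring, ← nsmul_eq_mul, h,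
    Polynomial.ascPochhammer_smeval_eq_eval]
  clear h
  induction k with
  | zero => simp [rising_zero]
  | succ k ih => rw [ascPochhammer_succ_eval, ih, rising_succ]

lemma choose_eq_rising_div (s : ℝ) (k : ℕ) :
    Ring.choose (s + k - 1) k = rising s k / k ! := by
  rw [← factorial_mul_choose, mul_div_cancel_left₀ _ (by positivity)]

lemma hasSum_one_sub_cpow (s : ℝ) {x : ℂ} (hx : ‖x‖ < 1) :
    HasSum (fun k => ((rising s k / k ! : ℝ) : ℂ) * x ^ k) (1 / (1 - x) ^ (s : ℂ)) := by
  have h := (Complex.one_div_one_sub_cpow_hasFPowerSeriesOnBall_zero s).hasSum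
    (y := x) (by simpa [Metric.mem_eball, edist_zero_right, ← ofReal_norm] using hx)
  simp only [zero_add] at h
  convert! h using 2 with k
  rw [FormalMultilinearSeries.ofScalars_apply_eq, ← choose_eq_rising_div, Complex.ofReal_choose]
  simp

lemma hasSum_one_sub_rpow (s : ℝ) {x : ℝ} (hx0 : 0 ≤ x) (hx : x < 1) :
    HasSum (fun k => rising s k / k ! * x ^ k) (1 / (1 - x) ^ s) := by
  have h := hasSum_one_sub_cpow s (x := (x : ℂ)) (by simpa [abs_of_nonneg hx0] using hx)
  rw [← Complex.hasSum_ofReal]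
  convert! h using 2
  · push_cast; ring
  · push_cast [Complex.ofReal_cpow (by linarith : 0 ≤ 1 - x)]; ring

lemma summable_norm_one_sub_cpow {s : ℝ} (hs : 0 < s) {x : ℂ} (hx : ‖x‖ < 1) :
    Summable fun k => ‖((rising s k / k ! : ℝ) : ℂ) * x ^ k‖ := by
  convert (hasSum_one_sub_rpow s (norm_nonneg x) hx).summable using 2 with k
  have := rising_pos hs k
  rw [norm_mul, norm_pow, Complex.norm_real, Real.norm_of_nonneg (by positivity)]

/-- The ratio of the Taylor coefficients of `₂F₁(a, a; l; x)`, `a = (l + t) / 2`, and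
`(1 - x)^(-t)`. -/
def coeffRatio (l t : ℝ) (k : ℕ) : ℝ :=
  rising ((l + t) / 2) k ^ 2 / (rising l k * rising t k)

/-- The limit of `coeffRatio`. -/
def coeffLimit (l t : ℝ) : ℝ :=
  Real.Gamma l * Real.Gamma t / Real.Gamma ((l + t) / 2) ^ 2

lemma coeffRatio_pos {l t : ℝ} (hl : 0 < l) (ht : 0 < t) (k : ℕ) : 0 < coeffRatio l t k := by
  have h1 := rising_pos hl k
  have h2 := rising_pos ht k
  have h3 := rising_pos (show 0 < (l + t) / 2 by positivity) k
  unfold coeffRatio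
  positivity

/-- The quotient of consecutive terms is `((l+t)/2 + k)² / ((l+k)(t+k))`, at least 1 by the
arithmetic-geometric mean inequality. -/
lemma coeffRatio_monotone {l t : ℝ} (hl : 0 < l) (ht : 0 < t) : Monotone (coeffRatio l t) := by
  refine monotone_nat_of_le_succ fun k => ?_
  have h1 := rising_pos hl k
  have h2 := rising_pos ht k
  have h3 := rising_pos (show 0 < (l + t) / 2 by positivity) k
  have h : coeffRatio l t (k + 1) =
      coeffRatio l t k * (((l + t) / 2 + k) ^ 2 / ((l + k) * (t + k))) := by
    unfold coeffRatio
    simp only [rising_succ]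
    field_simp
  rw [h]
  refine le_mul_of_one_le_right (coeffRatio_pos hl ht k).le ((one_le_div (by positivity)).2 ?_)
  nlinarith [sq_nonneg (l - t)]

/-- Euler's limit formula for `Γ` at `l`, `t` and `(l+t)/2`: the factorials cancel, and so do the
powers of `n`, because the middle argument occurs twice. -/
lemma tendsto_coeffRatio {l t : ℝ} (hl : 0 < l) (ht : 0 < t) :
    Tendsto (coeffRatio l t) atTop (𝓝 (coeffLimit l t)) := by
  -- `Real.GammaSeq s n` has the `n + 1` factors `s, …, s + n` in its denominator.
  rw [← tendsto_add_atTop_iff_nat 1]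
  have ha : 0 < (l + t) / 2 := by positivity
  have h := ((Real.GammaSeq_tendsto_Gamma l).mul (Real.GammaSeq_tendsto_Gamma t)).div
    ((Real.GammaSeq_tendsto_Gamma ((l + t) / 2)).pow 2)
    (pow_ne_zero 2 (Real.Gamma_pos_of_pos ha).ne')
  refine h.congr' ?_
  filter_upwards [eventually_gt_atTop 0] with n hn
  have hn' : (0 : ℝ) < n := by exact_mod_cast hn
  have e : ((n : ℝ) ^ ((l + t) / 2)) ^ 2 = (n : ℝ) ^ l * (n : ℝ) ^ t := by
    rw [← Real.rpow_natCast, ← Real.rpow_mul hn'.le, ← Real.rpow_add hn']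
    congr 1
    push_cast
    ring
  have h1 := rising_pos hl (n + 1)
  have h2 := rising_pos ht (n + 1)
  have h3 := rising_pos ha (n + 1)
  have hl' : (0 : ℝ) < (n : ℝ) ^ l := by positivity
  have ht' : (0 : ℝ) < (n : ℝ) ^ t := by positivity
  simp only [Pi.div_apply, Real.GammaSeq, coeffRatio]
  change (n : ℝ) ^ l * n ! / rising l (n + 1) * ((n : ℝ) ^ t * n ! / rising t (n + 1)) /
    ((n : ℝ) ^ ((l + t) / 2) * n ! / rising ((l + t) / 2) (n + 1)) ^ 2 = _
  rw [div_pow, mul_pow, e]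
  field_simp

lemma coeffRatio_le_limit {l t : ℝ} (hl : 0 < l) (ht : 0 < t) (k : ℕ) :
    coeffRatio l t k ≤ coeffLimit l t :=
  (coeffRatio_monotone hl ht).ge_of_tendsto (tendsto_coeffRatio hl ht) k

/-- The hypergeometric sum `₂F₁(a, a; l; x)` with `a = (l + t) / 2`. -/
def hyperSum (l t x : ℝ) : ℝ :=
  ∑' k : ℕ, coeffRatio l t k * (rising t k / k ! * x ^ k)

lemma summable_hyperSum {l t x : ℝ} (hl : 0 < l) (ht : 0 < t) (hx0 : 0 ≤ x) (hx : x < 1) :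
    Summable fun k : ℕ => coeffRatio l t k * (rising t k / k ! * x ^ k) := by
  have hs := (hasSum_one_sub_rpow t hx0 hx).summable.mul_left (coeffLimit l t)
  have hn : ∀ k : ℕ, 0 ≤ rising t k / k ! * x ^ k := fun k => by
    have := rising_pos ht k
    positivity
  refine hs.of_nonneg_of_le (fun k => mul_nonneg (coeffRatio_pos hl ht k).le (hn k)) fun k => ?_
  exact mul_le_mul_of_nonneg_right (coeffRatio_le_limit hl ht k) (hn k)

lemma hyperSum_le {l t x : ℝ} (hl : 0 < l) (ht : 0 < t) (hx0 : 0 ≤ x) (hx : x < 1) :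
    hyperSum l t x ≤ coeffLimit l t / (1 - x) ^ t := by
  have hs := (hasSum_one_sub_rpow t hx0 hx).mul_left (coeffLimit l t)
  rw [mul_one_div] at hs
  refine hasSum_le (fun k => ?_) (summable_hyperSum hl ht hx0 hx).hasSum hs
  refine mul_le_mul_of_nonneg_right (coeffRatio_le_limit hl ht k) ?_
  have := rising_pos ht k
  positivity

lemma one_sub_rpow_mul_hyperSum_le {l t x : ℝ} (hl : 0 < l) (ht : 0 < t) (hx0 : 0 ≤ x)
    (hx : x < 1) : (1 - x) ^ t * hyperSum l t x ≤ coeffLimit l t := by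
  have h := hyperSum_le hl ht hx0 hx
  have h1 : 0 < (1 - x) ^ t := Real.rpow_pos_of_pos (by linarith) t
  rwa [le_div_iff₀ h1, mul_comm] at h

/-- By monotonicity every ratio beyond index `K` is at least `coeffRatio l t K`. The first `K`
binomial terms are bounded uniformly in `x`, so the factor `(1-x)^t` removes them in the limit `x →
1`. -/
lemma le_one_sub_rpow_mul_hyperSum {l t x : ℝ} (hl : 0 < l) (ht : 0 < t) (hx0 : 0 ≤ x)
    (hx : x < 1) (K : ℕ) :
    coeffRatio l t K * (1 - (1 - x) ^ t * ∑ k ∈ Finset.range K, rising t k / k !) ≤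
      (1 - x) ^ t * hyperSum l t x := by
  have h1 : 0 < (1 - x) ^ t := Real.rpow_pos_of_pos (by linarith) t
  have hn : ∀ k : ℕ, 0 ≤ rising t k / k ! * x ^ k := fun k => by
    have := rising_pos ht k
    positivity
  have hb := hasSum_one_sub_rpow t hx0 hx
  have hF := summable_hyperSum hl ht hx0 hx
  have e1 := hb.summable.sum_add_tsum_nat_add K
  have e2 := hF.sum_add_tsum_nat_add K
  rw [hb.tsum_eq] at e1
  have l1 : ∑ k ∈ Finset.range K, rising t k / k ! * x ^ k ≤
      ∑ k ∈ Finset.range K, rising t k / k ! := by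
    refine Finset.sum_le_sum fun k _ => ?_
    have := rising_pos ht k
    exact mul_le_of_le_one_right (by positivity) (pow_le_one₀ hx0 hx.le)
  have l2 : 0 ≤ ∑ k ∈ Finset.range K, coeffRatio l t k * (rising t k / k ! * x ^ k) :=
    Finset.sum_nonneg fun k _ => mul_nonneg (coeffRatio_pos hl ht k).le (hn k)
  have l3 : coeffRatio l t K * ∑' k, rising t (k + K) / (k + K)! * x ^ (k + K) ≤
      ∑' k, coeffRatio l t (k + K) * (rising t (k + K) / (k + K)! * x ^ (k + K)) := by
    rw [← tsum_mul_left]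
    refine Summable.tsum_le_tsum (fun k => ?_)
      (((summable_nat_add_iff K).2 hb.summable).mul_left _) ((summable_nat_add_iff K).2 hF)
    exact mul_le_mul_of_nonneg_right (coeffRatio_monotone hl ht (Nat.le_add_left K k)) (hn _)
  have l4 : coeffRatio l t K * (1 / (1 - x) ^ t - ∑ k ∈ Finset.range K, rising t k / k !) ≤
      hyperSum l t x := by
    refine le_trans (mul_le_mul_of_nonneg_left ?_ (coeffRatio_pos hl ht K).le)
      (l3.trans (by rw [hyperSum]; linarith))
    linarith
  calc _ = (1 - x) ^ t *
        (coeffRatio l t K * (1 / (1 - x) ^ t - ∑ k ∈ Finset.range K, rising t k / k !)) := by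
        field_simp
    _ ≤ _ := mul_le_mul_of_nonneg_left l4 h1.le

lemma tendsto_one_sub_rpow_mul_hyperSum {l t : ℝ} (hl : 0 < l) (ht : 0 < t) :
    Tendsto (fun x : ℝ => (1 - x) ^ t * hyperSum l t x) (𝓝[<] 1) (𝓝 (coeffLimit l t)) := by
  have hev : ∀ᶠ x : ℝ in 𝓝[<] 1, 0 ≤ x ∧ x < 1 :=
    (Ico_mem_nhdsLT (show (0 : ℝ) < 1 by norm_num))
  refine tendsto_order.2 ⟨fun b hb => ?_, fun b hb => ?_⟩
  · obtain ⟨K, hK⟩ := ((tendsto_coeffRatio hl ht).eventually (lt_mem_nhds hb)).exists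
    have hlim : Tendsto (fun x : ℝ => coeffRatio l t K *
        (1 - (1 - x) ^ t * ∑ k ∈ Finset.range K, rising t k / k !)) (𝓝[<] 1)
        (𝓝 (coeffRatio l t K)) := by
      have hc : ContinuousAt (fun x : ℝ => coeffRatio l t K *
          (1 - (1 - x) ^ t * ∑ k ∈ Finset.range K, rising t k / k !)) 1 := by
        have : ContinuousAt (fun x : ℝ => (1 - x) ^ t) 1 :=
          (continuousAt_const.sub continuousAt_id).rpow_const (Or.inr ht.le)
        fun_prop
      have := hc.tendsto.mono_left (nhdsWithin_le_nhds (s := Set.Iio 1))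
      simpa [Real.zero_rpow ht.ne'] using this
    filter_upwards [hev, hlim.eventually (lt_mem_nhds hK)] with x hx hxl
    exact hxl.trans_le (le_one_sub_rpow_mul_hyperSum hl ht hx.1 hx.2 K)
  · filter_upwards [hev] with x hx
    exact (one_sub_rpow_mul_hyperSum_le hl ht hx.1 hx.2).trans_lt hb

end

/-! ### Moments of the weight `(1-|w|²)^σ` on the ball, by comparison with a Gaussian. -/

section

open Filter Topology Nat Set

/-- In polar coordinates the spherical factor does not depend on `g`, so two radial weights can be
compared through one-dimensional integrals alone. -/
lemma integral_radial_mul_homogeneous {E : Type*} [NormedAddCommGroup E] [NormedSpace ℝ E]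
    [MeasurableSpace E] [BorelSpace E] [FiniteDimensional ℝ E] [Nontrivial E] (μ : Measure E)
    [μ.IsAddHaarMeasure] (g : ℝ → ℝ) {h : E → ℝ} {m : ℕ}
    (hh : ∀ r : ℝ, 0 < r → ∀ x, h (r • x) = r ^ m * h x) :
    ∫ x, g ‖x‖ * h x ∂μ = (∫ s, h s ∂μ.toSphere) *
      ∫ y in Ioi (0 : ℝ), y ^ (Module.finrank ℝ E - 1) * (y ^ m * g y) := by
  calc ∫ x, g ‖x‖ * h x ∂μ
      = ∫ x : ({(0)}ᶜ : Set E), g ‖x.1‖ * h x.1 ∂(μ.comap (↑)) := by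
        rw [integral_subtype_comap (measurableSet_singleton _).compl fun x ↦ g (‖x‖) * h x,
          restrict_compl_singleton]
    _ = ∫ x : Metric.sphere (0 : E) 1 × Ioi (0 : ℝ), h x.1 * ((x.2 : ℝ) ^ m * g x.2)
          ∂μ.toSphere.prod (.volumeIoiPow (Module.finrank ℝ E - 1)) := by
        rw [← μ.measurePreserving_homeomorphUnitSphereProd.integral_comp
          (Homeomorph.measurableEmbedding _)]
        refine integral_congr_ae (Eventually.of_forall fun x => ?_)
        have hx : 0 < ‖x.1‖ := norm_pos_iff.2 x.2
        simp only [homeomorphUnitSphereProd_apply_fst_coe, homeomorphUnitSphereProd_apply_snd_coe]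
        rw [hh _ (by positivity), inv_pow]
        field_simp
    _ = (∫ s, h s ∂μ.toSphere) * ∫ y : Ioi (0 : ℝ), (y : ℝ) ^ m * g y
          ∂.volumeIoiPow (Module.finrank ℝ E - 1) :=
        integral_prod_mul (fun s : Metric.sphere (0 : E) 1 => h s)
          (fun y : Ioi (0 : ℝ) => (y : ℝ) ^ m * g y)
    _ = _ := by
        congr 1
        simp only [Measure.volumeIoiPow, ENNReal.ofReal]
        rw [integral_withDensity_eq_integral_smul,
          integral_subtype_comap measurableSet_Ioi
            fun a ↦ Real.toNNReal (a ^ (Module.finrank ℝ E - 1)) • (a ^ m * g a),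
          setIntegral_congr_fun measurableSet_Ioi fun x hx ↦ ?_]
        · rw [NNReal.smul_def, Real.coe_toNNReal _ (pow_nonneg hx.out.le _), smul_eq_mul]
        · exact (measurable_subtype_coe.pow_const _).real_toNNReal

lemma integral_betaPDFReal {α β : ℝ} (hα : 0 < α) (hβ : 0 < β) :
    ∫ x in Ioi (0 : ℝ), ProbabilityTheory.betaPDFReal α β x = 1 := by
  have hnn : ∀ x, 0 ≤ ProbabilityTheory.betaPDFReal α β x := fun x => by
    by_cases h : 0 < x ∧ x < 1
    · exact (ProbabilityTheory.betaPDFReal_pos h.1 h.2 hα hβ).le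
    · simp [ProbabilityTheory.betaPDFReal, h]
  rw [setIntegral_eq_integral_of_forall_compl_eq_zero,
    integral_eq_lintegral_of_nonneg_ae (Eventually.of_forall hnn)
      (ProbabilityTheory.measurable_betaPDFReal α β).aestronglyMeasurable]
  · have := ProbabilityTheory.lintegral_betaPDF_eq_one hα hβ
    simp only [ProbabilityTheory.betaPDF] at this
    rw [this]
    rfl
  · intro x hx
    have : ¬ (0 < x ∧ x < 1) := fun h => hx h.1
    simp [ProbabilityTheory.betaPDFReal, this]

/-- The substitution `x = y²` turns this into a Beta integral, evaluated through the total mass of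
the Beta density. -/
lemma integral_radial_ball {σ : ℝ} (hσ : -1 < σ) {d : ℕ} (hd : 1 ≤ d) (k : ℕ) :
    ∫ y in Ioi (0 : ℝ), y ^ (2 * d - 1) *
        (y ^ (2 * k) * (Iio (1 : ℝ)).indicator (fun y => (1 - y ^ 2) ^ σ) y) =
      Real.Gamma (d + k) * Real.Gamma (σ + 1) / Real.Gamma (d + k + (σ + 1)) / 2 := by
  have hα : (0 : ℝ) < d + k := by
    have : (1 : ℝ) ≤ d := by exact_mod_cast hd
    positivity
  have hβ : 0 < σ + 1 := by linarith
  have hB := ProbabilityTheory.beta_pos hα hβ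
  have h := integral_comp_rpow_Ioi_of_pos (g := ProbabilityTheory.betaPDFReal (d + k) (σ + 1))
    (p := 2) (by norm_num)
  rw [integral_betaPDFReal hα hβ] at h
  have h2 : ∫ y in Ioi (0 : ℝ), y ^ (2 * d - 1) *
        (y ^ (2 * k) * (Iio (1 : ℝ)).indicator (fun y => (1 - y ^ 2) ^ σ) y) =
      ∫ y in Ioi (0 : ℝ), (ProbabilityTheory.beta (d + k) (σ + 1) / 2) *
        ((2 * y ^ ((2 : ℝ) - 1)) • ProbabilityTheory.betaPDFReal (d + k) (σ + 1) (y ^ (2 : ℝ))) := by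
    refine setIntegral_congr_fun measurableSet_Ioi fun y (hy : 0 < y) => ?_
    simp only [smul_eq_mul, Real.rpow_two, ProbabilityTheory.betaPDFReal]
    by_cases h1 : y < 1
    · have hy2 : y ^ 2 < 1 := by nlinarith
      rw [indicator_of_mem (by exact h1), if_pos ⟨by positivity, hy2⟩]
      have e1 : (y ^ 2) ^ ((d : ℝ) + k - 1) * y = y ^ (2 * d - 1) * y ^ (2 * k) := by
        rw [← pow_add, ← Real.rpow_natCast, ← Real.rpow_natCast, ← Real.rpow_mul hy.le]
        nth_rw 2 [← Real.rpow_one y]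
        rw [← Real.rpow_add hy]
        congr 1
        push_cast [Nat.cast_sub (show 1 ≤ 2 * d by omega)]
        ring
      rw [← mul_assoc, ← e1, show (2 : ℝ) - 1 = 1 by norm_num, Real.rpow_one,
        show σ + 1 - 1 = σ by ring]
      field_simp
    · have hy2 : ¬ y ^ 2 < 1 := by nlinarith
      rw [indicator_of_notMem (by exact h1), if_neg (fun h => hy2 h.2)]
      simp
  rw [h2, integral_const_mul, h, mul_one, ProbabilityTheory.beta]

lemma integral_radial_gaussian {d : ℕ} (hd : 1 ≤ d) (k : ℕ) :
    ∫ y in Ioi (0 : ℝ), y ^ (2 * d - 1) * (y ^ (2 * k) * Real.exp (-y ^ 2)) =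
      Real.Gamma (d + k) / 2 := by
  have hd1 : (1 : ℝ) ≤ d := by exact_mod_cast hd
  have h := integral_rpow_mul_exp_neg_rpow (p := 2) (q := 2 * d - 1 + 2 * k) (by norm_num)
    (by have : (0 : ℝ) ≤ k := by positivity
        linarith)
  rw [show ((2 : ℝ) * d - 1 + 2 * k + 1) / 2 = d + k by ring] at h
  rw [← one_div_mul_eq_div, ← h]
  refine setIntegral_congr_fun measurableSet_Ioi fun y (hy : 0 < y) => ?_
  simp only [Real.rpow_two]
  rw [← mul_assoc, ← pow_add, ← Real.rpow_natCast]
  congr 2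
  push_cast [Nat.cast_sub (show 1 ≤ 2 * d by omega)]
  ring

lemma finrank_real_Cd (d : ℕ) : Module.finrank ℝ (Cd d) = 2 * d := by
  rw [(PiLp.continuousLinearEquiv 2 ℝ (fun _ : Fin d => ℂ)).toLinearEquiv.finrank_eq,
    Module.finrank_pi_fintype]
  simp [Complex.finrank_real_complex, mul_comm]

/-- Both sides have the same spherical integral, and the quotient of the radial ones is explicit.
The Gaussian side is useful because it factors over coordinates. -/
lemma integral_ball_mul_homogeneous {σ : ℝ} (hσ : -1 < σ) {d : ℕ} (hd : 1 ≤ d) {k : ℕ}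
    {h : Cd d → ℝ} (hh : ∀ r : ℝ, 0 < r → ∀ x, h (r • x) = r ^ (2 * k) * h x) :
    ∫ w in unitBall d, (1 - ‖w‖ ^ 2) ^ σ * h w =
      Real.Gamma (σ + 1) / Real.Gamma (d + 1 + σ + k) * ∫ w, Real.exp (-‖w‖ ^ 2) * h w := by
  have : Nonempty (Fin d) := ⟨⟨0, hd⟩⟩
  have : Nontrivial (Cd d) := by infer_instance
  have hα : (0 : ℝ) < d + k := by
    have : (1 : ℝ) ≤ d := by exact_mod_cast hd
    positivity
  have hG := (Real.Gamma_pos_of_pos hα).ne'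
  have e1 := integral_radial_mul_homogeneous (volume : Measure (Cd d))
    (fun y => Real.exp (-y ^ 2)) hh
  have e2 := integral_radial_mul_homogeneous (volume : Measure (Cd d))
    ((Iio (1 : ℝ)).indicator (fun y => (1 - y ^ 2) ^ σ)) hh
  rw [finrank_real_Cd, integral_radial_gaussian hd] at e1
  rw [finrank_real_Cd, integral_radial_ball hσ hd] at e2
  have e3 : ∫ w in unitBall d, (1 - ‖w‖ ^ 2) ^ σ * h w =
      ∫ w : Cd d, (Iio (1 : ℝ)).indicator (fun y => (1 - y ^ 2) ^ σ) ‖w‖ * h w := by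
    rw [← integral_indicator measurableSet_ball]
    refine integral_congr_ae (Eventually.of_forall fun w => ?_)
    by_cases hw : ‖w‖ < 1 <;> simp [indicator, hw]
  rw [e3, e2, e1, show (d : ℝ) + k + (σ + 1) = d + 1 + σ + k by ring]
  field_simp

/-- The constant absorbs the scaling between Lebesgue measure on `Cd d` and the product measure. Its
value is not needed: it cancels on normalizing by the moment `k = 0`. -/
lemma exists_gaussian_coordinate_moment (d : ℕ) : ∃ c : ℝ, 0 < c ∧ ∀ (i : Fin d) (k : ℕ),
    ∫ w : Cd d, Real.exp (-‖w‖ ^ 2) * ‖w i‖ ^ (2 * k) = c * k ! := by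
  let er := PiLp.continuousLinearEquiv 2 ℝ (fun _ : Fin d => ℂ)
  let ν : Measure (Fin d → ℂ) := (volume : Measure (Cd d)).map er
  have hν : ν.IsAddHaarMeasure := er.isAddHaarMeasure_map volume
  let c₀ := ν.addHaarScalarFactor volume
  have hc : ν = c₀ • volume := Measure.isAddLeftInvariant_eq_smul ν volume
  have hc0 : 0 < c₀ := Measure.addHaarScalarFactor_pos_of_isAddHaarMeasure _ _
  refine ⟨c₀ * Real.pi ^ d, by positivity, fun i k => ?_⟩
  have hmom : ∀ m : ℕ, ∫ u : ℂ, ‖u‖ ^ (2 * m) * Real.exp (-‖u‖ ^ 2) = Real.pi * m ! := by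
    intro m
    have := Complex.integral_rpow_mul_exp_neg_rpow (p := 2) (q := 2 * m) (by norm_num)
      (by have : (0 : ℝ) ≤ m := by positivity
          linarith)
    rw [show ((2 : ℝ) * m + 2) / 2 = m + 1 by ring, Real.Gamma_nat_eq_factorial] at this
    calc _ = _ := by
          refine integral_congr_ae (Eventually.of_forall fun u => ?_)
          simp only [Real.rpow_two]
          congr 1
          exact_mod_cast (Real.rpow_natCast ‖u‖ (2 * m)).symm
      _ = _ := this
      _ = _ := by ring
  let m : Fin d → ℕ := fun j => if j = i then k else 0
  have e1 : ∫ w : Cd d, Real.exp (-‖w‖ ^ 2) * ‖w i‖ ^ (2 * k) =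
      ∫ x, ∏ j, (‖x j‖ ^ (2 * m j) * Real.exp (-‖x j‖ ^ 2)) ∂ν := by
    have hme : MeasurableEmbedding er := er.toHomeomorph.measurableEmbedding
    rw [hme.integral_map]
    refine integral_congr_ae (Eventually.of_forall fun w => ?_)
    have e2 : ∀ j, er w j = w j := fun j => rfl
    simp only [e2, Finset.prod_mul_distrib, ← Real.exp_sum]
    rw [EuclideanSpace.norm_sq_eq, Finset.sum_neg_distrib, mul_comm]
    congr 1
    rw [Finset.prod_eq_single i (fun j _ hj => by simp [m, hj]) (by simp)]
    simp [m]
  rw [e1, hc, integral_smul_nnreal_measure,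
    MeasureTheory.integral_fintype_prod_volume_eq_prod
      (fun j (u : ℂ) => ‖u‖ ^ (2 * m j) * Real.exp (-‖u‖ ^ 2))]
  simp only [hmom, Finset.prod_mul_distrib, Finset.prod_const, Finset.card_univ, Fintype.card_fin]
  rw [Finset.prod_eq_single i (fun j _ hj => by simp [m, hj]) (by simp)]
  simp [m, NNReal.smul_def, mul_assoc]

lemma integral_comp_linearIsometryEquiv {d : ℕ} (U : Cd d ≃ₗᵢ[ℂ] Cd d) {F : Type*}
    [NormedAddCommGroup F] [NormedSpace ℝ F] (f : Cd d → F) :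
    ∫ w, f (U w) = ∫ w, f w := by
  let V : Cd d ≃ₗᵢ[ℝ] Cd d :=
    { U.toLinearEquiv.restrictScalars ℝ with norm_map' := fun x => U.norm_map x }
  exact V.measurePreserving.integral_comp V.toHomeomorph.measurableEmbedding f

/-- Extend `ζ` to an orthonormal basis and take coordinates in it. -/
lemma exists_linearIsometryEquiv_coord {d : ℕ} (hd : 1 ≤ d) {ζ : Cd d} (hζ : ‖ζ‖ = 1) :
    ∃ U : Cd d ≃ₗᵢ[ℂ] Cd d, ∀ w, U w ⟨0, hd⟩ = inner ℂ ζ w := by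
  let i : Fin d := ⟨0, hd⟩
  have hv : Orthonormal ℂ (({i} : Set (Fin d)).domRestrict fun _ => ζ) := by
    refine ⟨fun _ => hζ, fun a b hab => ?_⟩
    exact absurd (Subsingleton.elim a b) hab
  obtain ⟨b, hb⟩ := hv.exists_orthonormalBasis_extension_of_card_eq (by simp)
  refine ⟨b.repr, fun w => ?_⟩
  rw [b.repr_apply_apply, hb i (by simp [i])]

lemma exists_gaussian_moment {d : ℕ} (hd : 1 ≤ d) : ∃ c : ℝ, 0 < c ∧ ∀ (z : Cd d) (k : ℕ),
    ∫ w : Cd d, Real.exp (-‖w‖ ^ 2) * ‖inner ℂ w z‖ ^ (2 * k) = c * k ! * (‖z‖ ^ 2) ^ k := by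
  obtain ⟨c, hc, h⟩ := exists_gaussian_coordinate_moment d
  refine ⟨c, hc, fun z k => ?_⟩
  have key : ∀ ζ : Cd d, ‖ζ‖ = 1 →
      ∫ w : Cd d, Real.exp (-‖w‖ ^ 2) * ‖inner ℂ w ζ‖ ^ (2 * k) = c * k ! := by
    intro ζ hζ
    obtain ⟨U, hU⟩ := exists_linearIsometryEquiv_coord hd hζ
    rw [← h ⟨0, hd⟩ k, ← integral_comp_linearIsometryEquiv U
      (fun w => Real.exp (-‖w‖ ^ 2) * ‖w ⟨0, hd⟩‖ ^ (2 * k))]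
    simp only [U.norm_map, hU, norm_inner_symm ζ]
  rcases eq_or_ne z 0 with rfl | hz
  · rcases Nat.eq_zero_or_pos k with rfl | hk
    · simpa using h ⟨0, hd⟩ 0
    · simp [hk.ne']
  · have hz0 : ‖z‖ ≠ 0 := norm_ne_zero_iff.2 hz
    rw [← key (((‖z‖ : ℂ)⁻¹) • z) (by simp [norm_smul, hz0]), ← integral_mul_const]
    refine integral_congr_ae (Eventually.of_forall fun w => ?_)
    simp only [inner_smul_right, norm_mul, norm_inv, Complex.norm_real, norm_norm, mul_pow, inv_pow,
      ← pow_mul]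
    field_simp

end

/-! ### The probability measure `bergmanMeasure` and the exact integral of the kernel's modulus. -/

section

open Filter Topology Nat Set ComplexConjugate

lemma integral_ballMeasure {d : ℕ} {F : Type*} [NormedAddCommGroup F] [NormedSpace ℝ F]
    (f : Cd d → F) :
    ∫ w, f w ∂(ballMeasure d) = (volume.real (unitBall d))⁻¹ • ∫ w in unitBall d, f w := by
  rw [ballMeasure, integral_smul_measure, ENNReal.toReal_inv, Measure.real]

lemma ae_ballMeasure (d : ℕ) : ∀ᵐ w ∂(ballMeasure d), ‖w‖ < 1 := by
  have h : ∀ᵐ w ∂(volume.restrict (unitBall d)), ‖w‖ < 1 := by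
    filter_upwards [ae_restrict_mem measurableSet_ball] with w hw
    simpa using hw
  exact Measure.ae_smul_measure h _

lemma volume_real_unitBall_pos (d : ℕ) : 0 < volume.real (unitBall d) :=
  ENNReal.toReal_pos (Metric.measure_ball_pos volume 0 one_pos).ne' measure_ball_lt_top.ne

lemma exists_ball_moment {σ : ℝ} (hσ : -1 < σ) {d : ℕ} (hd : 1 ≤ d) :
    ∃ c : ℝ, 0 < c ∧ ∀ (z : Cd d) (k : ℕ),
      ∫ w, (1 - ‖w‖ ^ 2) ^ σ * ‖inner ℂ w z‖ ^ (2 * k) ∂(ballMeasure d) =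
        c * (k ! / Real.Gamma ((d : ℝ) + 1 + σ + k) * (‖z‖ ^ 2) ^ k) := by
  obtain ⟨c, hc, h⟩ := exists_gaussian_moment hd
  have hv := volume_real_unitBall_pos d
  have hG := Real.Gamma_pos_of_pos (show 0 < σ + 1 by linarith)
  refine ⟨(volume.real (unitBall d))⁻¹ * Real.Gamma (σ + 1) * c, by positivity, fun z k => ?_⟩
  rw [integral_ballMeasure, integral_ball_mul_homogeneous hσ hd, h]
  · rw [smul_eq_mul]; ring
  · intro r hr x
    rw [RCLike.real_smul_eq_coe_smul (K := ℂ), inner_smul_left, norm_mul, mul_pow]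
    simp [abs_of_pos hr]

lemma integral_weight_pos {σ : ℝ} (hσ : -1 < σ) {d : ℕ} (hd : 1 ≤ d) :
    0 < ∫ w, (1 - ‖w‖ ^ 2) ^ σ ∂(ballMeasure d) := by
  obtain ⟨c, hc, h⟩ := exists_ball_moment hσ hd
  have h0 := h 0 0
  simp only [mul_zero, pow_zero, mul_one] at h0
  rw [h0]
  have := Real.Gamma_pos_of_pos (show 0 < (d : ℝ) + 1 + σ + (0 : ℕ) by
    have : (0 : ℝ) ≤ d := by positivity
    push_cast
    linarith)
  positivity

/-- The Bochner integral of a non-integrable function is 0, whereas this one has been computed to be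
positive. -/
lemma integrable_weight {σ : ℝ} (hσ : -1 < σ) {d : ℕ} (hd : 1 ≤ d) :
    Integrable (fun w : Cd d => (1 - ‖w‖ ^ 2) ^ σ) (ballMeasure d) := by
  by_contra h
  exact (integral_weight_pos hσ hd).ne' (integral_undef h)

lemma bergmanConst_pos {σ : ℝ} (hσ : -1 < σ) {d : ℕ} (hd : 1 ≤ d) : 0 < bergmanConst d σ :=
  inv_pos.2 (integral_weight_pos hσ hd)

/-- The probability measure `c_σ (1-|w|²)^σ dv(w)` on the ball. -/
def bergmanMeasure (d : ℕ) (σ : ℝ) : Measure (Cd d) :=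
  (ballMeasure d).withDensity fun w => ENNReal.ofReal (bergmanConst d σ * (1 - ‖w‖ ^ 2) ^ σ)

lemma measurable_bergmanDensity (d : ℕ) (σ : ℝ) :
    Measurable fun w : Cd d => bergmanConst d σ * (1 - ‖w‖ ^ 2) ^ σ := by
  fun_prop

lemma bergmanDensity_nonneg {σ : ℝ} (hσ : -1 < σ) {d : ℕ} (hd : 1 ≤ d) {w : Cd d}
    (hw : ‖w‖ < 1) : 0 ≤ bergmanConst d σ * (1 - ‖w‖ ^ 2) ^ σ :=
  mul_nonneg (bergmanConst_pos hσ hd).le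
    (Real.rpow_nonneg (by nlinarith [norm_nonneg w]) _)

lemma isProbabilityMeasure_bergmanMeasure {σ : ℝ} (hσ : -1 < σ) {d : ℕ} (hd : 1 ≤ d) :
    IsProbabilityMeasure (bergmanMeasure d σ) := by
  refine ⟨?_⟩
  rw [bergmanMeasure, withDensity_apply _ MeasurableSet.univ, Measure.restrict_univ,
    ← ofReal_integral_eq_lintegral_ofReal ((integrable_weight hσ hd).const_mul _),
    integral_const_mul, bergmanConst, inv_mul_cancel₀ (integral_weight_pos hσ hd).ne',
    ENNReal.ofReal_one]
  filter_upwards [ae_ballMeasure d] with w hw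
  exact bergmanDensity_nonneg hσ hd hw

lemma bergmanMeasure_absolutelyContinuous (d : ℕ) (σ : ℝ) :
    bergmanMeasure d σ ≪ ballMeasure d := withDensity_absolutelyContinuous _ _

lemma ae_bergmanMeasure (d : ℕ) (σ : ℝ) : ∀ᵐ w ∂(bergmanMeasure d σ), ‖w‖ < 1 :=
  (bergmanMeasure_absolutelyContinuous d σ).ae_le (ae_ballMeasure d)

section

variable {F : Type*} [NormedAddCommGroup F] [NormedSpace ℝ F]

lemma integral_bergmanMeasure {σ : ℝ} (hσ : -1 < σ) {d : ℕ} (hd : 1 ≤ d) (f : Cd d → F) :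
    ∫ w, f w ∂(bergmanMeasure d σ) =
      bergmanConst d σ • ∫ w, ((1 - ‖w‖ ^ 2) ^ σ : ℝ) • f w ∂(ballMeasure d) := by
  rw [bergmanMeasure, integral_withDensity_eq_integral_toReal_smul
    (measurable_bergmanDensity d σ).ennreal_ofReal (by simp), ← integral_smul]
  refine integral_congr_ae ?_
  filter_upwards [ae_ballMeasure d] with w hw
  rw [ENNReal.toReal_ofReal (bergmanDensity_nonneg hσ hd hw), mul_smul]

lemma integrable_bergmanMeasure_iff {σ : ℝ} (hσ : -1 < σ) {d : ℕ} (hd : 1 ≤ d) (f : Cd d → F) :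
    Integrable f (bergmanMeasure d σ) ↔
      Integrable (fun w => ((1 - ‖w‖ ^ 2) ^ σ : ℝ) • f w) (ballMeasure d) := by
  rw [bergmanMeasure, integrable_withDensity_iff_integrable_smul'
    (measurable_bergmanDensity d σ).ennreal_ofReal (by simp),
    ← integrable_fun_smul_iff (bergmanConst_pos hσ hd).ne'
      (fun w : Cd d => ((1 - ‖w‖ ^ 2) ^ σ : ℝ) • f w)]
  refine integrable_congr ?_
  filter_upwards [ae_ballMeasure d] with w hw
  rw [ENNReal.toReal_ofReal (bergmanDensity_nonneg hσ hd hw), mul_smul]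

lemma integral_bergmanMeasure_comp {σ : ℝ} (hσ : -1 < σ) {d : ℕ} (hd : 1 ≤ d)
    (U : Cd d ≃ₗᵢ[ℂ] Cd d) (f : Cd d → F) :
    ∫ w, f (U w) ∂(bergmanMeasure d σ) = ∫ w, f w ∂(bergmanMeasure d σ) := by
  rw [integral_bergmanMeasure hσ hd, integral_bergmanMeasure hσ hd, integral_ballMeasure,
    integral_ballMeasure]
  congr 2
  rw [← integral_indicator measurableSet_ball, ← integral_indicator measurableSet_ball,
    ← integral_comp_linearIsometryEquiv U
      ((unitBall d).indicator fun w => ((1 - ‖w‖ ^ 2) ^ σ : ℝ) • f w)]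
  refine integral_congr_ae (Eventually.of_forall fun w => ?_)
  simp [indicator, U.norm_map]

end

lemma integral_norm_inner_pow {σ : ℝ} (hσ : -1 < σ) {d : ℕ} (hd : 1 ≤ d) (z : Cd d) (k : ℕ) :
    ∫ w, ‖inner ℂ w z‖ ^ (2 * k) ∂(bergmanMeasure d σ) =
      k ! / rising ((d : ℝ) + 1 + σ) k * (‖z‖ ^ 2) ^ k := by
  obtain ⟨c, hc, h⟩ := exists_ball_moment hσ hd
  have hl : 0 < (d : ℝ) + 1 + σ := by
    have : (0 : ℝ) ≤ d := by positivity
    linarith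
  have h0 := h 0 0
  simp only [mul_zero, pow_zero, mul_one, Nat.factorial_zero, Nat.cast_one, Nat.cast_zero,
    add_zero] at h0
  have hG := Real.Gamma_pos_of_pos hl
  have hr := rising_pos hl k
  simp only [integral_bergmanMeasure hσ hd, smul_eq_mul, h, bergmanConst, h0]
  rw [Gamma_add_natCast hl]
  field_simp

lemma integral_inner_pow_mul_conj {σ : ℝ} (hσ : -1 < σ) {d : ℕ} (hd : 1 ≤ d) (z : Cd d)
    {j k : ℕ} (hjk : j ≠ k) :
    ∫ w, inner ℂ w z ^ j * conj (inner ℂ w z) ^ k ∂(bergmanMeasure d σ) = 0 := by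
  have hne : (k : ℂ) - j ≠ 0 := sub_ne_zero.2 (by exact_mod_cast hjk.symm)
  -- Rotating `w` by `u = e^(iθ)` multiplies the integrand by `e^(iθ(k-j))`. This `θ` makes the
  -- factor `-1`, so invariance of the measure forces the integral to equal its own negative.
  let θ : ℝ := Real.pi / ((k : ℝ) - j)
  let u : ℂ := Complex.exp (θ * Complex.I)
  have hu : ‖u‖ = 1 := Complex.norm_exp_ofReal_mul_I θ
  have hu0 : u ≠ 0 := Complex.exp_ne_zero _
  let U : Cd d ≃ₗᵢ[ℂ] Cd d :=
    { LinearEquiv.smulOfNeZero ℂ (Cd d) u hu0 with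
      norm_map' := fun w => by
        change ‖u • w‖ = ‖w‖
        rw [norm_smul, hu, one_mul] }
  have hU : ∀ w, U w = u • w := fun w => rfl
  have hphase : conj u ^ j * u ^ k = -1 := by
    simp only [u]
    rw [← Complex.exp_conj, ← Complex.exp_nat_mul, ← Complex.exp_nat_mul, ← Complex.exp_add,
      ← Complex.exp_pi_mul_I]
    congr 1
    simp only [θ, map_mul, Complex.conj_ofReal, Complex.conj_I]
    push_cast
    field_simp
    ring
  have h := integral_bergmanMeasure_comp hσ hd U
    fun w => inner ℂ w z ^ j * conj (inner ℂ w z) ^ k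
  have h2 : ∀ w : Cd d, inner ℂ (U w) z ^ j * conj (inner ℂ (U w) z) ^ k =
      (-1 : ℂ) * (inner ℂ w z ^ j * conj (inner ℂ w z) ^ k) := by
    intro w
    rw [hU, inner_smul_left, map_mul, Complex.conj_conj, mul_pow, mul_pow, ← hphase]
    ring
  simp only [h2, integral_const_mul] at h
  linear_combination (-1 / 2 : ℂ) * h

lemma norm_inner_le_left {d : ℕ} (z : Cd d) {w : Cd d} (hw : ‖w‖ < 1) :
    ‖(inner ℂ w z : ℂ)‖ ≤ ‖z‖ := by
  refine (norm_inner_le_norm w z).trans ?_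
  exact mul_le_of_le_one_left (norm_nonneg _) hw.le

lemma one_sub_norm_le {d : ℕ} (z : Cd d) {w : Cd d} (hw : ‖w‖ < 1) :
    1 - ‖z‖ ≤ ‖1 - (inner ℂ w z : ℂ)‖ := by
  have h := norm_sub_norm_le (1 : ℂ) (inner ℂ w z)
  rw [norm_one] at h
  linarith [norm_inner_le_left z hw]

lemma tsum_mul_conj_eq {f : ℕ → ℂ} {s : ℂ} (hf : HasSum f s) (hn : Summable fun k => ‖f k‖) :
    ∑' q : ℕ × ℕ, f q.1 * conj (f q.2) = ((‖s‖ ^ 2 : ℝ) : ℂ) := by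
  have hn2 : Summable fun k => ‖conj (f k)‖ := by simpa only [RCLike.norm_conj] using hn
  rw [← tsum_mul_tsum_of_summable_norm hn hn2, ← Complex.conj_tsum, hf.tsum_eq, Complex.mul_conj,
    Complex.normSq_eq_norm_sq]

/-- Orthogonal expansion of `∫ |h(⟨z,w⟩)|²` for a power series `h` converging absolutely. -/
lemma hasSum_integral_norm_sq {σ : ℝ} (hσ : -1 < σ) {d : ℕ} (hd : 1 ≤ d) {z : Cd d}
    {b : ℕ → ℝ} {h : ℂ → ℂ}
    (hb : Summable fun k => ‖(b k : ℂ) * (‖z‖ : ℂ) ^ k‖)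
    (hh : ∀ x : ℂ, ‖x‖ ≤ ‖z‖ → HasSum (fun k => (b k : ℂ) * x ^ k) (h x)) :
    HasSum (fun k : ℕ => b k ^ 2 * (k ! / rising ((d : ℝ) + 1 + σ) k * (‖z‖ ^ 2) ^ k))
      (∫ w, ‖h (inner ℂ w z)‖ ^ 2 ∂(bergmanMeasure d σ)) := by
  have hP := isProbabilityMeasure_bergmanMeasure hσ hd
  let μ := bergmanMeasure d σ
  let T : ℕ × ℕ → Cd d → ℂ := fun q w =>
    ((b q.1 : ℂ) * inner ℂ w z ^ q.1) * conj ((b q.2 : ℂ) * inner ℂ w z ^ q.2)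
  have hTle : ∀ q, ∀ᵐ w ∂μ, ‖T q w‖ ≤
      ‖(b q.1 : ℂ) * (‖z‖ : ℂ) ^ q.1‖ * ‖(b q.2 : ℂ) * (‖z‖ : ℂ) ^ q.2‖ := by
    intro q
    filter_upwards [ae_bergmanMeasure d σ] with w hw
    have hi := norm_inner_le_left z hw
    simp only [T, norm_mul, RCLike.norm_conj, norm_pow, Complex.norm_real, norm_norm]
    gcongr
  have hTm : ∀ q, AEStronglyMeasurable (T q) μ := by
    intro q
    have : Continuous (T q) := by
      simp only [T]
      fun_prop
    exact this.aestronglyMeasurable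
  have hTi : ∀ q, Integrable (T q) μ := fun q =>
    Integrable.of_bound (hTm q) _ (hTle q)
  -- Absolute convergence at radius `‖z‖` dominates the double series, so sum and integral may be
  -- exchanged.
  have hsum : Summable fun q => ∫ w, ‖T q w‖ ∂μ := by
    refine Summable.of_nonneg_of_le (fun q => integral_nonneg fun _ => norm_nonneg _) (fun q => ?_)
      (Summable.mul_of_nonneg hb hb (fun _ => norm_nonneg _) (fun _ => norm_nonneg _))
    calc ∫ w, ‖T q w‖ ∂μ ≤ ∫ w, ‖(b q.1 : ℂ) * (‖z‖ : ℂ) ^ q.1‖ *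
          ‖(b q.2 : ℂ) * (‖z‖ : ℂ) ^ q.2‖ ∂μ :=
          integral_mono_ae (hTi q).norm (integrable_const _) (hTle q)
      _ = _ := by simp
  have hmain := hasSum_integral_of_summable_integral_norm hTi hsum
  have hts : ∫ w, ∑' q, T q w ∂μ = ((∫ w, ‖h (inner ℂ w z)‖ ^ 2 ∂μ : ℝ) : ℂ) := by
    rw [← integral_complex_ofReal]
    refine integral_congr_ae ?_
    filter_upwards [ae_bergmanMeasure d σ] with w hw
    have hi := norm_inner_le_left z hw
    have hs := hh _ hi
    have hn : Summable fun k => ‖(b k : ℂ) * (inner ℂ w z : ℂ) ^ k‖ := by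
      refine hb.of_nonneg_of_le (fun _ => norm_nonneg _) fun k => ?_
      simp only [norm_mul, norm_pow, Complex.norm_real, norm_norm]
      gcongr
    exact tsum_mul_conj_eq hs hn
  rw [hts] at hmain
  -- Only the diagonal of the double series survives, by orthogonality of distinct powers.
  have hdiag : Function.Injective (fun k : ℕ => (k, k)) := fun a b hab => (Prod.mk.inj hab).1
  rw [← hdiag.hasSum_iff] at hmain
  · rw [← Complex.hasSum_ofReal]
    convert! hmain using 2 with k
    simp only [Function.comp]
    rw [← integral_norm_inner_pow hσ hd, ← integral_const_mul, ← integral_complex_ofReal]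
    refine integral_congr_ae (Eventually.of_forall fun w => ?_)
    simp only [T, Complex.mul_conj, Complex.normSq_eq_norm_sq, norm_mul, norm_pow,
      Complex.norm_real, Real.norm_eq_abs, mul_pow, sq_abs]
    push_cast
    ring
  · rintro ⟨j, k⟩ hq
    have hjk : j ≠ k := fun h => hq ⟨j, by simp [h]⟩
    have := integral_inner_pow_mul_conj hσ hd z hjk
    calc ∫ w, T (j, k) w ∂μ
        = ∫ w, ((b j : ℂ) * b k) * (inner ℂ w z ^ j * conj (inner ℂ w z) ^ k) ∂μ := by
          refine integral_congr_ae (Eventually.of_forall fun w => ?_)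
          simp only [T, map_mul, map_pow, Complex.conj_ofReal]
          ring
      _ = 0 := by rw [integral_const_mul, this, mul_zero]

/-- The integrand is the squared modulus of `(1-⟨z,w⟩)^(-a)` with `a = (l+t)/2`, so the orthogonal
expansion applies to its binomial series. -/
lemma integral_kernel_rpow {σ : ℝ} (hσ : -1 < σ) {d : ℕ} (hd : 1 ≤ d) {t : ℝ} (ht : 0 < t)
    {z : Cd d} (hz : ‖z‖ < 1) :
    ∫ w, 1 / ‖1 - (inner ℂ w z : ℂ)‖ ^ ((d : ℝ) + 1 + σ + t) ∂(bergmanMeasure d σ) =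
      hyperSum ((d : ℝ) + 1 + σ) t (‖z‖ ^ 2) := by
  have hl : 0 < (d : ℝ) + 1 + σ := by
    have : (0 : ℝ) ≤ d := by positivity
    linarith
  set l := (d : ℝ) + 1 + σ with hl_def
  have ha : 0 < (l + t) / 2 := by positivity
  have h := hasSum_integral_norm_sq hσ hd (b := fun k => rising ((l + t) / 2) k / k !)
    (h := fun x => 1 / (1 - x) ^ (((l + t) / 2 : ℝ) : ℂ))
    (summable_norm_one_sub_cpow ha (by simpa using hz))
    (fun x hx => hasSum_one_sub_cpow _ (hx.trans_lt hz))
  rw [hyperSum]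
  refine Eq.trans ?_ (h.tsum_eq.symm.trans ?_)
  · refine integral_congr_ae ?_
    filter_upwards [ae_bergmanMeasure d σ] with w hw
    have hpos : 0 < ‖1 - (inner ℂ w z : ℂ)‖ := lt_of_lt_of_le (by linarith) (one_sub_norm_le z hw)
    rw [norm_div, norm_one, Complex.norm_cpow_real, div_pow, one_pow, ← Real.rpow_natCast,
      ← Real.rpow_mul hpos.le]
    congr 2
    push_cast
    ring
  · refine tsum_congr fun k => ?_
    have h1 := rising_pos hl k
    have h2 := rising_pos ht k
    simp only [coeffRatio, ← hl_def]
    field_simp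

end

/-! ### Differentiation of the kernel integrals. -/

section

open Filter Topology Set ComplexConjugate

lemma rising_add (s : ℝ) (m n : ℕ) : rising s (m + n) = rising s m * rising (s + m) n := by
  rw [rising, Finset.prod_range_add]
  simp only [rising, Nat.cast_add, add_assoc]

/-- `g` is measurable and essentially bounded. -/
def EssBounded {d : ℕ} (μ : Measure (Cd d)) (g : Cd d → ℂ) : Prop :=
  AEStronglyMeasurable g μ ∧ ∃ M : ℝ, ∀ᵐ w ∂μ, ‖g w‖ ≤ M

lemma EssBounded.mul {d : ℕ} {μ : Measure (Cd d)} {f g : Cd d → ℂ} (hf : EssBounded μ f)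
    (hg : EssBounded μ g) : EssBounded μ fun w => f w * g w := by
  obtain ⟨M, hM⟩ := hf.2
  obtain ⟨N, hN⟩ := hg.2
  refine ⟨hf.1.mul hg.1, |M| * |N|, ?_⟩
  filter_upwards [hM, hN] with w h1 h2
  rw [norm_mul]
  exact mul_le_mul (h1.trans (le_abs_self M)) (h2.trans (le_abs_self N)) (norm_nonneg _)
    (abs_nonneg _)

lemma essBounded_const {d : ℕ} (μ : Measure (Cd d)) (c : ℂ) : EssBounded μ fun _ => c :=
  ⟨aestronglyMeasurable_const, ‖c‖, Eventually.of_forall fun _ => le_rfl⟩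

lemma essBounded_conj_coord (d : ℕ) (σ : ℝ) (j : Fin d) :
    EssBounded (bergmanMeasure d σ) fun w => conj (w j) := by
  refine ⟨Continuous.aestronglyMeasurable (by fun_prop), 1, ?_⟩
  filter_upwards [ae_bergmanMeasure d σ] with w hw
  rw [RCLike.norm_conj]
  exact (PiLp.norm_apply_le w j).trans hw.le

lemma EssBounded.pow {d : ℕ} {μ : Measure (Cd d)} {f : Cd d → ℂ} (hf : EssBounded μ f) (m : ℕ) :
    EssBounded μ fun w => f w ^ m := by
  induction m with
  | zero => simpa using essBounded_const μ 1
  | succ m ih => simpa only [pow_succ] using ih.mul hf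

lemma EssBounded.integrable {d : ℕ} {μ : Measure (Cd d)} [IsFiniteMeasure μ] {f : Cd d → ℂ}
    (hf : EssBounded μ f) : Integrable f μ := by
  obtain ⟨M, hM⟩ := hf.2
  exact Integrable.of_bound hf.1 M hM

lemma one_sub_inner_ne_zero {d : ℕ} {z w : Cd d} (hz : ‖z‖ < 1) (hw : ‖w‖ < 1) :
    1 - (inner ℂ w z : ℂ) ≠ 0 :=
  norm_pos_iff.1 (lt_of_lt_of_le (by linarith) (one_sub_norm_le z hw))

lemma one_sub_inner_mem_slitPlane {d : ℕ} {z w : Cd d} (hz : ‖z‖ < 1) (hw : ‖w‖ < 1) :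
    1 - (inner ℂ w z : ℂ) ∈ Complex.slitPlane := by
  left
  have h := (Complex.re_le_norm (inner ℂ w z)).trans (norm_inner_le_left z hw)
  rw [Complex.sub_re, Complex.one_re]
  linarith

lemma norm_one_sub_inner_cpow {d : ℕ} (z w : Cd d) (s : ℝ) :
    ‖(1 - (inner ℂ w z : ℂ)) ^ (-(s : ℂ))‖ = 1 / ‖1 - (inner ℂ w z : ℂ)‖ ^ s := by
  rw [← Complex.ofReal_neg, Complex.norm_cpow_real, Real.rpow_neg (norm_nonneg _), one_div]

lemma norm_one_sub_inner_cpow_le {d : ℕ} {z w : Cd d} {ρ : ℝ} (hρ : ρ < 1) (hz : ‖z‖ ≤ ρ)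
    (hw : ‖w‖ < 1) {s : ℝ} (hs : 0 ≤ s) :
    ‖(1 - (inner ℂ w z : ℂ)) ^ (-(s : ℂ))‖ ≤ 1 / (1 - ρ) ^ s := by
  rw [norm_one_sub_inner_cpow]
  have h := one_sub_norm_le z hw
  have : 0 < 1 - ρ := by linarith
  gcongr
  linarith

lemma measurable_one_sub_inner_cpow {d : ℕ} (z : Cd d) (c : ℂ) :
    Measurable fun w : Cd d => (1 - (inner ℂ w z : ℂ)) ^ c := by
  have : Measurable fun w : Cd d => 1 - (inner ℂ w z : ℂ) :=
    Continuous.measurable (by fun_prop)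
  exact this.pow_const c

lemma essBounded_kernel (d : ℕ) (σ : ℝ) {z : Cd d} (hz : ‖z‖ < 1) {s : ℝ} (hs : 0 ≤ s) :
    EssBounded (bergmanMeasure d σ) fun w => (1 - (inner ℂ w z : ℂ)) ^ (-(s : ℂ)) := by
  refine ⟨(measurable_one_sub_inner_cpow z _).aestronglyMeasurable, 1 / (1 - ‖z‖) ^ s, ?_⟩
  filter_upwards [ae_bergmanMeasure d σ] with w hw
  exact norm_one_sub_inner_cpow_le hz le_rfl hw hs

/-- The integral `c_σ ∫ (1-|w|²)^σ (1-⟨z,w⟩)^(-s) g(w) dv(w)`. -/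
def kernelIntegral (d : ℕ) (σ s : ℝ) (g : Cd d → ℂ) (z : Cd d) : ℂ :=
  ∫ w, (1 - (inner ℂ w z : ℂ)) ^ (-(s : ℂ)) * g w ∂(bergmanMeasure d σ)

lemma bergmanProj_eq_kernelIntegral {σ : ℝ} (hσ : -1 < σ) {d : ℕ} (hd : 1 ≤ d) (G : Cd d → ℂ)
    (z : Cd d) : bergmanProj d σ G z = kernelIntegral d σ ((d : ℝ) + 1 + σ) G z := by
  rw [kernelIntegral, integral_bergmanMeasure hσ hd, bergmanProj, Complex.real_smul]
  congr 1
  refine integral_congr_ae (Eventually.of_forall fun w => ?_)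
  simp only [bergmanKernel, Complex.real_smul, Complex.cpow_neg]
  ring

lemma integrable_bergmanKernel_mul {σ : ℝ} (hσ : -1 < σ) {d : ℕ} (hd : 1 ≤ d) {G : Cd d → ℂ}
    (hG : EssBounded (bergmanMeasure d σ) G) {z : Cd d} (hz : ‖z‖ < 1) :
    Integrable (fun w => bergmanKernel d σ z w * G w) (ballMeasure d) := by
  have := isProbabilityMeasure_bergmanMeasure hσ hd
  have hl : 0 ≤ (d : ℝ) + 1 + σ := by
    have : (0 : ℝ) ≤ d := by positivity
    linarith
  have h := ((essBounded_kernel d σ hz hl).mul hG).integrable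
  rw [integrable_bergmanMeasure_iff hσ hd] at h
  refine h.congr (Eventually.of_forall fun w => ?_)
  simp only [bergmanKernel, Complex.real_smul, Complex.cpow_neg]
  ring

lemma hasFDerivAt_kernel {d : ℕ} {x w : Cd d} (hx : ‖x‖ < 1) (hw : ‖w‖ < 1) (s : ℝ) (c : ℂ) :
    HasFDerivAt (fun z => (1 - (inner ℂ w z : ℂ)) ^ (-(s : ℂ)) * c)
      (((1 - (inner ℂ w x : ℂ)) ^ (-((s + 1 : ℝ) : ℂ)) * (s * c)) • innerSL ℂ w) x := by
  have h1 : HasFDerivAt (fun z => 1 - (inner ℂ w z : ℂ)) (-(innerSL ℂ w)) x := by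
    simpa using ((innerSL ℂ w).hasFDerivAt (x := x)).const_sub 1
  have h2 := ((Complex.hasStrictDerivAt_cpow_const (c := -(s : ℂ))
    (one_sub_inner_mem_slitPlane hx hw)).hasDerivAt.comp_hasFDerivAt x h1).mul_const c
  refine h2.congr_fderiv ?_
  ext v
  simp only [smul_apply, neg_apply, smul_eq_mul]
  rw [show -(s : ℂ) - 1 = -((s + 1 : ℝ) : ℂ) by push_cast; ring]
  ring

lemma hasFDerivAt_kernelIntegral {σ : ℝ} (hσ : -1 < σ) {d : ℕ} (hd : 1 ≤ d) {s : ℝ} (hs : 0 ≤ s)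
    {g : Cd d → ℂ} (hg : EssBounded (bergmanMeasure d σ) g) {z : Cd d} (hz : ‖z‖ < 1) :
    HasFDerivAt (kernelIntegral d σ s g)
      (∫ w, ((1 - (inner ℂ w z : ℂ)) ^ (-((s + 1 : ℝ) : ℂ)) * (s * g w)) • innerSL ℂ w
        ∂(bergmanMeasure d σ)) z ∧
    Integrable (fun w => ((1 - (inner ℂ w z : ℂ)) ^ (-((s + 1 : ℝ) : ℂ)) * (s * g w)) •
      innerSL ℂ w) (bergmanMeasure d σ) := by
  have := isProbabilityMeasure_bergmanMeasure hσ hd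
  obtain ⟨M, hM⟩ := hg.2
  -- The ball of radius `(1 - ‖z‖) / 2` about `z` stays within `‖x‖ ≤ ρ < 1`, where the
  -- differentiated kernel is bounded uniformly in `w`.
  set ρ := (1 + ‖z‖) / 2 with hρ_def
  have hρ : ρ < 1 := by linarith
  have hball : ∀ x ∈ Metric.ball z ((1 - ‖z‖) / 2), ‖x‖ ≤ ρ := by
    intro x hx
    rw [Metric.mem_ball, dist_eq_norm] at hx
    have := norm_add_le (x - z) z
    rw [sub_add_cancel] at this
    linarith
  have hmeas : AEStronglyMeasurable (fun w => ((1 - (inner ℂ w z : ℂ)) ^ (-((s + 1 : ℝ) : ℂ)) *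
      (s * g w)) • innerSL ℂ w) (bergmanMeasure d σ) :=
    ((measurable_one_sub_inner_cpow z _).aestronglyMeasurable.mul (hg.1.const_mul _)).smul
      (innerSL ℂ).continuous.aestronglyMeasurable
  have hbound : ∀ᵐ w ∂(bergmanMeasure d σ), ∀ x ∈ Metric.ball z ((1 - ‖z‖) / 2),
      ‖((1 - (inner ℂ w x : ℂ)) ^ (-((s + 1 : ℝ) : ℂ)) * (s * g w)) • innerSL ℂ w‖ ≤
        1 / (1 - ρ) ^ (s + 1) * (s * M) := by
    filter_upwards [ae_bergmanMeasure d σ, hM] with w hw hMw x hx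
    have h1 := norm_one_sub_inner_cpow_le hρ (hball x hx) hw (show 0 ≤ s + 1 by linarith)
    have h0 : 0 < 1 - ρ := by linarith
    rw [norm_smul, norm_mul, norm_mul, Complex.norm_real, Real.norm_of_nonneg hs, innerSL_apply_norm]
    have h2 : s * ‖g w‖ ≤ s * M := mul_le_mul_of_nonneg_left hMw hs
    calc _ ≤ (1 / (1 - ρ) ^ (s + 1) * (s * M)) * 1 :=
          mul_le_mul (mul_le_mul h1 h2 (by positivity) (by positivity)) hw.le (norm_nonneg _)
            (mul_nonneg (by positivity) (le_trans (by positivity) h2))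
      _ = _ := mul_one _
  have hnhds : Metric.ball z ((1 - ‖z‖) / 2) ∈ 𝓝 z := Metric.ball_mem_nhds z (by linarith)
  refine ⟨?_, Integrable.of_bound hmeas _
    (hbound.mono fun w hw => hw z (Metric.mem_ball_self (by linarith)))⟩
  refine hasFDerivAt_integral_of_dominated_of_fderiv_le hnhds ?_ ?_ hmeas hbound
    (integrable_const _) ?_
  · exact Eventually.of_forall fun x =>
      (measurable_one_sub_inner_cpow x _).aestronglyMeasurable.mul hg.1
  · exact ((essBounded_kernel d σ hz hs).mul hg).integrable
  · filter_upwards [ae_bergmanMeasure d σ] with w hw x hx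
    exact hasFDerivAt_kernel ((hball x hx).trans_lt hρ) hw s (g w)

/-- A derivative raises the exponent by one and multiplies the density by `s * conj (w j)`, so the
class of kernel integrals is preserved. Equality is asked only on the open ball, which suffices for
derivatives there and allows iteration. -/
lemma partialDeriv_eq_kernelIntegral {σ : ℝ} (hσ : -1 < σ) {d : ℕ} (hd : 1 ≤ d) {s : ℝ}
    (hs : 0 ≤ s) {g : Cd d → ℂ} (hg : EssBounded (bergmanMeasure d σ) g) {f : Cd d → ℂ}
    (hf : EqOn f (kernelIntegral d σ s g) (unitBall d)) (j : Fin d) :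
    EqOn (partialDeriv j f) (kernelIntegral d σ (s + 1) fun w => s * conj (w j) * g w)
      (unitBall d) := by
  intro z hz
  have hz1 : ‖z‖ < 1 := by simpa using hz
  obtain ⟨h, hi⟩ := hasFDerivAt_kernelIntegral hσ hd hs hg hz1
  have h2 := h.congr_of_eventuallyEq
    (hf.eventuallyEq_of_mem (Metric.isOpen_ball.mem_nhds hz))
  rw [partialDeriv, (h2.hasLineDerivAt _).lineDeriv, ContinuousLinearMap.integral_apply hi,
    kernelIntegral]
  refine integral_congr_ae (Eventually.of_forall fun w => ?_)
  simp only [smul_apply, smul_eq_mul, innerSL_apply_apply]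
  rw [EuclideanSpace.inner_single_right]
  ring

lemma iterate_partialDeriv_eq {σ : ℝ} (hσ : -1 < σ) {d : ℕ} (hd : 1 ≤ d) {s : ℝ}
    (hs : 0 ≤ s) {g : Cd d → ℂ} (hg : EssBounded (bergmanMeasure d σ) g) {f : Cd d → ℂ}
    (hf : EqOn f (kernelIntegral d σ s g) (unitBall d)) (j : Fin d) (m : ℕ) :
    EqOn ((partialDeriv j)^[m] f)
      (kernelIntegral d σ (s + m) fun w => rising s m * conj (w j) ^ m * g w) (unitBall d) := by
  induction m with
  | zero => simpa [rising_zero] using hf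
  | succ m ih =>
    rw [Function.iterate_succ_apply']
    have hb : EssBounded (bergmanMeasure d σ) fun w => rising s m * conj (w j) ^ m * g w :=
      ((essBounded_const _ _).mul ((essBounded_conj_coord d σ j).pow m)).mul hg
    have h := partialDeriv_eq_kernelIntegral hσ hd (by positivity) hb ih j
    convert! h using 2
    · push_cast; ring
    · funext w
      rw [rising_succ]
      push_cast
      ring

lemma mixedPartial_eq_kernelIntegral {σ : ℝ} (hσ : -1 < σ) {d : ℕ} (hd : 1 ≤ d) {s : ℝ}
    (hs : 0 ≤ s) {g : Cd d → ℂ} (hg : EssBounded (bergmanMeasure d σ) g) {f : Cd d → ℂ}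
    (hf : EqOn f (kernelIntegral d σ s g) (unitBall d)) {n : ℕ} {α : Fin d → ℕ}
    (hα : α ∈ multiIndices d n) :
    EqOn (mixedPartial α f)
      (kernelIntegral d σ (s + n) fun w => rising s n * conj (monomials w α) * g w)
      (unitBall d) := by
  -- `mixedPartial` is a fold over `List.finRange d`, so the induction runs over arbitrary lists and
  -- carries boundedness of the density along.
  have key : ∀ l : List (Fin d),
      EssBounded (bergmanMeasure d σ) (fun w => rising s (l.map α).sum *
        (l.map fun j => conj (w j) ^ α j).prod * g w) ∧
      EqOn (l.foldr (fun j g => (partialDeriv j)^[α j] g) f)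
        (kernelIntegral d σ (s + (l.map α).sum) fun w => rising s (l.map α).sum *
          (l.map fun j => conj (w j) ^ α j).prod * g w) (unitBall d) := by
    intro l
    induction l with
    | nil => simpa [rising_zero] using ⟨hg, hf⟩
    | cons j l ih =>
      have e : (fun w : Cd d => ((rising (s + (l.map α).sum) (α j) : ℝ) : ℂ) * conj (w j) ^ α j *
          (rising s (l.map α).sum * (l.map fun j => conj (w j) ^ α j).prod * g w)) =
          fun w => rising s ((j :: l).map α).sum *
            ((j :: l).map fun j => conj (w j) ^ α j).prod * g w := by
        funext w
        rw [List.map_cons, List.sum_cons, List.map_cons, List.prod_cons, add_comm (α j),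
          rising_add]
        push_cast
        ring
      rw [← e]
      refine ⟨((essBounded_const _ _).mul ((essBounded_conj_coord d σ j).pow _)).mul ih.1, ?_⟩
      have h := iterate_partialDeriv_eq hσ hd (by positivity) ih.1 ih.2 j (α j)
      rw [List.foldr_cons]
      convert! h using 2
      rw [List.map_cons, List.sum_cons]
      push_cast
      ring
  have h := (key (List.finRange d)).2
  have e1 : ((List.finRange d).map α).sum = n := by
    rw [← mem_multiIndices.1 hα, ← List.sum_ofFn, List.ofFn_eq_map]
  rw [e1] at h
  convert! h using 4 with w
  rw [monomials, map_prod, ← List.prod_ofFn, List.ofFn_eq_map]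
  simp

end

/-! ### Membership in the Bloch space and the upper bound for the norm. -/

section

open Filter Topology Set ComplexConjugate

/-- Minkowski's integral inequality, as the norm bound for a Bochner integral with values in `PiLp`.
-/
lemma ellp_integral_le {d n : ℕ} {p : ℝ} (hp : 1 ≤ p) {Ω : Type*} [MeasurableSpace Ω]
    {μ : Measure Ω} {Φ : Ω → (Fin d → ℕ) → ℂ}
    (hΦ : ∀ α ∈ multiIndices d n, Integrable (fun w => Φ w α) μ) :
    ellp d n p (fun α => ∫ w, Φ w α ∂μ) ≤ ∫ w, ellp d n p (Φ w) ∂μ := by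
  have hP : Fact (1 ≤ ENNReal.ofReal p) := ⟨by simpa using hp⟩
  let Ψ : Ω → PiLp (ENNReal.ofReal p) (fun _ : multiIndices d n => ℂ) :=
    fun w => WithLp.toLp _ fun α => Φ w α
  have h1 : ∀ α, Integrable (fun w => Ψ w α) μ := fun α => hΦ α α.2
  have h2 : ellp d n p (fun α => ∫ w, Φ w α ∂μ) = ‖∫ w, Ψ w ∂μ‖ := by
    rw [ellp_eq_norm d n hp]
    congr 1
    ext α
    rw [eval_integral_piLp h1]
  rw [h2]
  refine (norm_integral_le_integral_norm _).trans (le_of_eq ?_)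
  exact integral_congr_ae (Eventually.of_forall fun w => (ellp_eq_norm d n hp (Φ w)).symm)

lemma integrable_ellp {d n : ℕ} {p : ℝ} (hp : 1 ≤ p) {Ω : Type*} [MeasurableSpace Ω]
    {μ : Measure Ω} {Φ : Ω → (Fin d → ℕ) → ℂ}
    (hΦ : ∀ α ∈ multiIndices d n, Integrable (fun w => Φ w α) μ) :
    Integrable (fun w => ellp d n p (Φ w)) μ := by
  have hP : Fact (1 ≤ ENNReal.ofReal p) := ⟨by simpa using hp⟩
  have h : Integrable (fun w => (WithLp.toLp (ENNReal.ofReal p) fun α : multiIndices d n => Φ w α))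
      μ := Integrable.of_eval_piLp fun α => hΦ α α.2
  exact h.norm.congr (Eventually.of_forall fun w => (ellp_eq_norm d n hp (Φ w)).symm)

lemma parameter_pos {σ : ℝ} (hσ : -1 < σ) (d : ℕ) : 0 < (d : ℝ) + 1 + σ := by
  have : (0 : ℝ) ≤ d := by positivity
  linarith

lemma coeffLimit_pos {l t : ℝ} (hl : 0 < l) (ht : 0 < t) : 0 < coeffLimit l t :=
  (coeffRatio_pos hl ht 0).trans_le (coeffRatio_le_limit hl ht 0)

lemma rising_mul_coeffLimit {l : ℝ} (hl : 0 < l) (n : ℕ) :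
    rising l n * coeffLimit l n =
      Real.Gamma (l + n) * Real.Gamma n / Real.Gamma ((l + n) / 2) ^ 2 := by
  rw [Gamma_add_natCast hl, coeffLimit]
  ring

lemma norm_sq_lt_one {d : ℕ} {z : Cd d} (hz : ‖z‖ < 1) : ‖z‖ ^ 2 < 1 := by
  nlinarith [norm_nonneg z]

lemma integrable_kernel_rpow {σ : ℝ} (hσ : -1 < σ) {d : ℕ} (hd : 1 ≤ d) {s : ℝ} (hs : 0 ≤ s)
    {z : Cd d} (hz : ‖z‖ < 1) :
    Integrable (fun w => 1 / ‖1 - (inner ℂ w z : ℂ)‖ ^ s) (bergmanMeasure d σ) := by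
  have := isProbabilityMeasure_bergmanMeasure hσ hd
  exact (essBounded_kernel d σ hz hs).integrable.norm.congr
    (Eventually.of_forall fun w => norm_one_sub_inner_cpow z w s)

lemma norm_kernelIntegral_le {σ : ℝ} (hσ : -1 < σ) {d : ℕ} (hd : 1 ≤ d) {t : ℝ} (ht : 0 < t)
    {g : Cd d → ℂ} {M : ℝ} (hM0 : 0 ≤ M) (hM : ∀ᵐ w ∂(bergmanMeasure d σ), ‖g w‖ ≤ M)
    {z : Cd d} (hz : ‖z‖ < 1) :
    ‖kernelIntegral d σ ((d : ℝ) + 1 + σ + t) g z‖ ≤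
      coeffLimit ((d : ℝ) + 1 + σ) t / (1 - ‖z‖ ^ 2) ^ t * M := by
  have hl := parameter_pos hσ d
  calc _ ≤ ∫ w, 1 / ‖1 - (inner ℂ w z : ℂ)‖ ^ ((d : ℝ) + 1 + σ + t) * M
        ∂(bergmanMeasure d σ) := by
        refine norm_integral_le_of_norm_le
          ((integrable_kernel_rpow hσ hd (by positivity) hz).mul_const M) ?_
        filter_upwards [hM] with w hw
        rw [norm_mul, norm_one_sub_inner_cpow]
        gcongr
    _ ≤ _ := by
        rw [integral_mul_const, integral_kernel_rpow hσ hd ht hz]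
        exact mul_le_mul_of_nonneg_right
          (hyperSum_le hl ht (by positivity) (norm_sq_lt_one hz)) hM0

/-- The kernel estimate with `t = 1` bounds each first partial derivative by a multiple of `1 / (1 -
‖z‖²)`. -/
lemma memBloch_bergmanProj {σ : ℝ} (hσ : -1 < σ) {d : ℕ} (hd : 1 ≤ d) {G : Cd d → ℂ}
    (hG : EssBounded (bergmanMeasure d σ) G) : MemBloch d (bergmanProj d σ G) := by
  have hl := parameter_pos hσ d
  set l := (d : ℝ) + 1 + σ with hl_def
  have hEq : bergmanProj d σ G = kernelIntegral d σ l G :=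
    funext fun z => bergmanProj_eq_kernelIntegral hσ hd G z
  rw [hEq]
  obtain ⟨M, hM⟩ := hG.2
  refine ⟨fun z hz => ((hasFDerivAt_kernelIntegral hσ hd hl.le hG
    (by simpa using hz)).1.differentiableAt).differentiableWithinAt,
    Real.sqrt d * (coeffLimit l 1 * (l * |M|)), fun z hz => ?_⟩
  have hz1 : ‖z‖ < 1 := by simpa using hz
  have hr : 0 < 1 - ‖z‖ ^ 2 := by linarith [norm_sq_lt_one hz1]
  have hL := coeffLimit_pos hl one_pos
  set K := coeffLimit l 1 * (l * |M|) / (1 - ‖z‖ ^ 2) with hK_def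
  have hK : 0 ≤ K := by positivity
  have hj : ∀ j, ‖partialDeriv j (kernelIntegral d σ l G) z‖ ≤ K := by
    intro j
    rw [partialDeriv_eq_kernelIntegral hσ hd hl.le hG (fun _ _ => rfl) j hz]
    have h := norm_kernelIntegral_le hσ hd one_pos (M := l * |M|) (by positivity)
      (g := fun w => l * conj (w j) * G w) (z := z) (by
        filter_upwards [hM, ae_bergmanMeasure d σ] with w h1 h2
        rw [norm_mul, norm_mul, Complex.norm_real, Real.norm_of_nonneg hl.le, RCLike.norm_conj]
        have h3 : ‖w j‖ ≤ 1 := (PiLp.norm_apply_le w j).trans h2.le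
        have h4 : ‖G w‖ ≤ |M| := h1.trans (le_abs_self M)
        calc l * ‖w j‖ * ‖G w‖ ≤ l * 1 * |M| := by gcongr
          _ = _ := by ring) hz1
    rw [Real.rpow_one] at h
    exact h.trans (le_of_eq (by rw [hK_def]; ring))
  have hs : Real.sqrt (∑ j, ‖partialDeriv j (kernelIntegral d σ l G) z‖ ^ 2) ≤
      Real.sqrt d * K := by
    rw [← Real.sqrt_sq hK, ← Real.sqrt_mul (by positivity)]
    refine Real.sqrt_le_sqrt ?_
    calc _ ≤ ∑ _j : Fin d, K ^ 2 :=
          Finset.sum_le_sum fun j _ => pow_le_pow_left₀ (norm_nonneg _) (hj j) 2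
      _ = _ := by simp
  calc _ ≤ (1 - ‖z‖ ^ 2) * (Real.sqrt d * K) := mul_le_mul_of_nonneg_left hs hr.le
    _ = _ := by
      rw [hK_def]
      field_simp

lemma mixedPartial_bergmanProj {σ : ℝ} (hσ : -1 < σ) {d n : ℕ} (hd : 1 ≤ d) {G : Cd d → ℂ}
    (hG : EssBounded (bergmanMeasure d σ) G) {α : Fin d → ℕ} (hα : α ∈ multiIndices d n)
    {z : Cd d} (hz : z ∈ unitBall d) :
    mixedPartial α (bergmanProj d σ G) z =
      ∫ w, (1 - (inner ℂ w z : ℂ)) ^ (-(((d : ℝ) + 1 + σ + n : ℝ) : ℂ)) *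
        (rising ((d : ℝ) + 1 + σ) n * conj (monomials w α) * G w) ∂(bergmanMeasure d σ) :=
  mixedPartial_eq_kernelIntegral hσ hd (parameter_pos hσ d).le hG
    (fun z _ => bergmanProj_eq_kernelIntegral hσ hd G z) hα hz

lemma essBounded_conj_monomials (d : ℕ) (σ : ℝ) (α : Fin d → ℕ) :
    EssBounded (bergmanMeasure d σ) fun w => conj (monomials w α) := by
  refine ⟨(Complex.continuous_conj.comp (continuous_monomials α)).aestronglyMeasurable, 1, ?_⟩
  filter_upwards [ae_bergmanMeasure d σ] with w hw
  rw [RCLike.norm_conj]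
  exact norm_monomials_le_one hw.le α

lemma blochSeminorm_term_le {σ : ℝ} (hσ : -1 < σ) {d n : ℕ} (hd : 1 ≤ d) (hn : 1 ≤ n) {p : ℝ}
    (hp : 1 ≤ p) {C : ℝ}
    (hC : IsGreatest ((fun ζ : Cd d => ellp d n p (monomials ζ)) '' Metric.sphere 0 1) C)
    {G : Cd d → ℂ} (hG : EssBounded (bergmanMeasure d σ) G)
    (hG1 : ∀ᵐ w ∂(bergmanMeasure d σ), ‖G w‖ ≤ 1) {z : Cd d} (hz : z ∈ unitBall d) :
    (1 - ‖z‖ ^ 2) ^ n * ellp d n p (fun α => mixedPartial α (bergmanProj d σ G) z) ≤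
      C * (rising ((d : ℝ) + 1 + σ) n * coeffLimit ((d : ℝ) + 1 + σ) n) := by
  have := isProbabilityMeasure_bergmanMeasure hσ hd
  have hl := parameter_pos hσ d
  set l := (d : ℝ) + 1 + σ with hl_def
  have hz1 : ‖z‖ < 1 := by simpa using hz
  have hn0 : (0 : ℝ) < n := by exact_mod_cast hn
  have hr := rising_pos hl n
  have hC0 : 0 ≤ C := by
    obtain ⟨ζ, _, rfl⟩ := hC.1
    exact ellp_nonneg _ _ _ _
  let Φ : Cd d → (Fin d → ℕ) → ℂ := fun w α =>
    (1 - (inner ℂ w z : ℂ)) ^ (-((l + n : ℝ) : ℂ)) * (rising l n * conj (monomials w α) * G w)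
  have hΦ : ∀ α ∈ multiIndices d n, Integrable (fun w => Φ w α) (bergmanMeasure d σ) :=
    fun α _ => ((essBounded_kernel d σ hz1 (by positivity)).mul
      (((essBounded_const _ _).mul (essBounded_conj_monomials d σ α)).mul hG)).integrable
  have e1 : ellp d n p (fun α => mixedPartial α (bergmanProj d σ G) z) =
      ellp d n p (fun α => ∫ w, Φ w α ∂(bergmanMeasure d σ)) :=
    ellp_congr fun α hα => by rw [mixedPartial_bergmanProj hσ hd hG hα hz]
  have e2 : ∫ w, ellp d n p (Φ w) ∂(bergmanMeasure d σ) ≤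
      ∫ w, 1 / ‖1 - (inner ℂ w z : ℂ)‖ ^ (l + n) * (rising l n * C) ∂(bergmanMeasure d σ) := by
    refine integral_mono_ae (integrable_ellp hp hΦ)
      ((integrable_kernel_rpow hσ hd (by positivity) hz1).mul_const _) ?_
    filter_upwards [hG1, ae_bergmanMeasure d σ] with w h1 h2
    calc ellp d n p (Φ w)
        ≤ ellp d n p (fun α => ((1 - (inner ℂ w z : ℂ)) ^ (-((l + n : ℝ) : ℂ)) * rising l n) *
            monomials w α) := by
          refine ellp_mono hp fun α _ => ?_
          simp only [Φ, norm_mul, RCLike.norm_conj]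
          calc _ = ‖(1 - (inner ℂ w z : ℂ)) ^ (-((l + n : ℝ) : ℂ))‖ * ‖((rising l n : ℝ) : ℂ)‖ *
                ‖monomials w α‖ * ‖G w‖ := by ring
            _ ≤ _ := mul_le_of_le_one_right (by positivity) h1
      _ = 1 / ‖1 - (inner ℂ w z : ℂ)‖ ^ (l + n) *
            (rising l n * ellp d n p (monomials w)) := by
          rw [ellp_mul_left hp, norm_mul, norm_one_sub_inner_cpow, Complex.norm_real,
            Real.norm_of_nonneg hr.le, mul_assoc]
      _ ≤ _ := by
          have := ellp_monomials_le hn hp hC h2.le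
          gcongr
  rw [integral_mul_const, integral_kernel_rpow hσ hd hn0 hz1] at e2
  have e3 := one_sub_rpow_mul_hyperSum_le hl hn0 (sq_nonneg ‖z‖) (norm_sq_lt_one hz1)
  rw [Real.rpow_natCast] at e3
  have h0 : 0 ≤ 1 - ‖z‖ ^ 2 := by linarith [norm_sq_lt_one hz1]
  calc _ ≤ (1 - ‖z‖ ^ 2) ^ n * (hyperSum l n (‖z‖ ^ 2) * (rising l n * C)) := by
        rw [e1]
        exact mul_le_mul_of_nonneg_left ((ellp_integral_le hp hΦ).trans e2) (by positivity)
    _ = ((1 - ‖z‖ ^ 2) ^ n * hyperSum l n (‖z‖ ^ 2)) * (rising l n * C) := by ring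
    _ ≤ coeffLimit l n * (rising l n * C) := mul_le_mul_of_nonneg_right e3 (by positivity)
    _ = _ := by ring

lemma essBounded_of_memLp {d : ℕ} (σ : ℝ) {G : Cd d → ℂ} (hG : MemLp G ∞ (ballMeasure d)) :
    EssBounded (bergmanMeasure d σ) G := by
  have hac := bergmanMeasure_absolutelyContinuous d σ
  refine ⟨hG.1.mono_ac hac, (eLpNorm G ∞ (ballMeasure d)).toReal, ?_⟩
  refine hac.ae_le ?_
  filter_upwards [ae_le_eLpNormEssSup (f := G) (μ := ballMeasure d)] with w hw
  rw [← eLpNorm_exponent_top] at hw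
  rw [← toReal_enorm]
  exact ENNReal.toReal_mono hG.2.ne hw

lemma ae_norm_le_one {d : ℕ} (σ : ℝ) {G : Cd d → ℂ} (hG : eLpNorm G ∞ (ballMeasure d) ≤ 1) :
    ∀ᵐ w ∂(bergmanMeasure d σ), ‖G w‖ ≤ 1 := by
  refine (bergmanMeasure_absolutelyContinuous d σ).ae_le ?_
  filter_upwards [ae_le_eLpNormEssSup (f := G) (μ := ballMeasure d)] with w hw
  rw [← eLpNorm_exponent_top] at hw
  have := ENNReal.toReal_mono ENNReal.one_ne_top (hw.trans hG)
  simpa using this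

lemma bergmanOpNorm_le {σ : ℝ} (hσ : -1 < σ) {d n : ℕ} (hd : 1 ≤ d) (hn : 1 ≤ n) {p : ℝ}
    (hp : 1 ≤ p) {C : ℝ}
    (hC : IsGreatest ((fun ζ : Cd d => ellp d n p (monomials ζ)) '' Metric.sphere 0 1) C) :
    bergmanOpNorm d n p σ ≤
      ENNReal.ofReal (C * (rising ((d : ℝ) + 1 + σ) n * coeffLimit ((d : ℝ) + 1 + σ) n)) :=
  iSup_le fun _ => iSup_le fun hG => iSup_le fun hG1 => iSup₂_le fun _ hz =>
    ENNReal.ofReal_le_ofReal (blochSeminorm_term_le hσ hd hn hp hC (essBounded_of_memLp σ hG)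
      (ae_norm_le_one σ hG1) hz)

end

/-! ### Sharpness: concentration of the kernel at a boundary point. -/

section

open Filter Topology Set ComplexConjugate

lemma norm_mul_sub_mul_le {a a' b b' : ℂ} (hb : ‖b‖ ≤ 1) (ha' : ‖a'‖ ≤ 1) :
    ‖a * b - a' * b'‖ ≤ ‖a - a'‖ + ‖b - b'‖ := by
  rw [show a * b - a' * b' = (a - a') * b + a' * (b - b') by ring]
  refine (norm_add_le _ _).trans ?_
  rw [norm_mul, norm_mul]
  exact add_le_add (mul_le_of_le_one_right (norm_nonneg _) hb)
    (mul_le_of_le_one_left (norm_nonneg _) ha')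

lemma norm_pow_sub_pow_le_mul {a b : ℂ} (ha : ‖a‖ ≤ 1) (hb : ‖b‖ ≤ 1) (m : ℕ) :
    ‖a ^ m - b ^ m‖ ≤ m * ‖a - b‖ := by
  induction m with
  | zero => simp
  | succ m ih =>
    rw [pow_succ, pow_succ]
    refine (norm_mul_sub_mul_le ha (by rw [norm_pow]; exact pow_le_one₀ (norm_nonneg _) hb)).trans ?_
    push_cast
    linarith

lemma norm_monomials_sub_le {d : ℕ} {w ζ : Cd d} (hw : ‖w‖ ≤ 1) (hζ : ‖ζ‖ ≤ 1) {n : ℕ}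
    {α : Fin d → ℕ} (hα : α ∈ multiIndices d n) :
    ‖monomials w α - monomials ζ α‖ ≤ n * ‖w - ζ‖ := by
  have hw' : ∀ j, ‖w j‖ ≤ 1 := fun j => (PiLp.norm_apply_le w j).trans hw
  have hζ' : ∀ j, ‖ζ j‖ ≤ 1 := fun j => (PiLp.norm_apply_le ζ j).trans hζ
  have key : ∀ s : Finset (Fin d), ‖∏ j ∈ s, w j ^ α j - ∏ j ∈ s, ζ j ^ α j‖ ≤
      (∑ j ∈ s, (α j : ℝ)) * ‖w - ζ‖ := by
    intro s
    induction s using Finset.induction_on with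
    | empty => simp
    | insert i s hi ih =>
      rw [Finset.prod_insert hi, Finset.prod_insert hi, Finset.sum_insert hi, add_mul]
      refine (norm_mul_sub_mul_le ?_ ?_).trans (add_le_add ?_ ih)
      · rw [norm_prod]
        refine Finset.prod_le_one (fun _ _ => norm_nonneg _) fun j _ => ?_
        rw [norm_pow]
        exact pow_le_one₀ (norm_nonneg _) (hw' j)
      · rw [norm_pow]
        exact pow_le_one₀ (norm_nonneg _) (hζ' i)
      · refine (norm_pow_sub_pow_le_mul (hw' i) (hζ' i) _).trans ?_
        exact mul_le_mul_of_nonneg_left (PiLp.norm_apply_le (w - ζ) i) (by positivity)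
  have h := key Finset.univ
  rw [← Nat.cast_sum, mem_multiIndices.1 hα] at h
  exact h

/-- With `x = ⟨ζ,w⟩`, expanding the square gives `|w-ζ|² ≤ 2 Re(1-x) ≤ 2|1-x|`. Moreover `|1-x| ≤
|1-rx| + (1-r) ≤ 2|1-rx|`. -/
lemma norm_sub_le_rpow_kernel {d : ℕ} {w ζ : Cd d} (hw : ‖w‖ < 1) (hζ : ‖ζ‖ = 1) {r : ℝ}
    (hr0 : 0 ≤ r) (hr1 : r < 1) :
    ‖w - ζ‖ ≤ 2 * ‖1 - (inner ℂ w ((r : ℂ) • ζ) : ℂ)‖ ^ (1 / 2 : ℝ) := by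
  set x : ℂ := inner ℂ w ζ
  have hx : ‖x‖ ≤ 1 := hζ ▸ norm_inner_le_left ζ hw
  have hz : ‖(r : ℂ) • ζ‖ = r := by simp [norm_smul, hζ, abs_of_nonneg hr0]
  have h1 : 1 - r ≤ ‖1 - (inner ℂ w ((r : ℂ) • ζ) : ℂ)‖ := by
    simpa only [hz] using one_sub_norm_le ((r : ℂ) • ζ) hw
  rw [inner_smul_right] at h1 ⊢
  change 1 - r ≤ ‖1 - r * x‖ at h1
  change ‖w - ζ‖ ≤ 2 * ‖1 - r * x‖ ^ (1 / 2 : ℝ)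
  have h2 : ‖1 - x‖ ≤ 2 * ‖1 - r * x‖ := by
    calc ‖1 - x‖ = ‖(1 - r * x) - ((1 - r : ℝ) : ℂ) * x‖ := by push_cast; congr 1; ring
      _ ≤ ‖1 - r * x‖ + (1 - r) * ‖x‖ := by
        refine (norm_sub_le _ _).trans ?_
        rw [norm_mul, Complex.norm_real, Real.norm_of_nonneg (by linarith)]
      _ ≤ _ := by nlinarith
  have h3 : ‖w - ζ‖ ^ 2 ≤ 2 * ‖1 - x‖ := by
    have e := norm_sub_sq (𝕜 := ℂ) w ζ
    have hre := Complex.re_le_norm (1 - x)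
    rw [Complex.sub_re, Complex.one_re] at hre
    rw [e, hζ]
    change ‖w‖ ^ 2 - 2 * x.re + 1 ^ 2 ≤ _
    nlinarith [norm_nonneg w]
  rw [← Real.sqrt_eq_rpow]
  refine abs_le_of_sq_le_sq' ?_ (by positivity) |>.2
  rw [mul_pow, Real.sq_sqrt (norm_nonneg _)]
  linarith

/-- The extremal function, the unimodular factor aligning `(1-⟨z,w⟩)^(-s)` with its modulus. -/
def alignedPhase (d : ℕ) (s : ℝ) (z w : Cd d) : ℂ :=
  conj ((1 - (inner ℂ w z : ℂ)) ^ (-(s : ℂ))) / ‖(1 - (inner ℂ w z : ℂ)) ^ (-(s : ℂ))‖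

lemma norm_alignedPhase_le (d : ℕ) (s : ℝ) (z w : Cd d) : ‖alignedPhase d s z w‖ ≤ 1 := by
  rw [alignedPhase, norm_div, RCLike.norm_conj, Complex.norm_real, norm_norm]
  exact div_self_le_one _

lemma mul_alignedPhase (d : ℕ) (s : ℝ) (z w : Cd d) :
    (1 - (inner ℂ w z : ℂ)) ^ (-(s : ℂ)) * alignedPhase d s z w =
      ((1 / ‖1 - (inner ℂ w z : ℂ)‖ ^ s : ℝ) : ℂ) := by
  rw [alignedPhase, ← norm_one_sub_inner_cpow]
  set u := (1 - (inner ℂ w z : ℂ)) ^ (-(s : ℂ))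
  rcases eq_or_ne u 0 with h | h
  · simp [h]
  · have : ((‖u‖ : ℝ) : ℂ) ≠ 0 := by simpa using h
    rw [mul_div_assoc', Complex.mul_conj, Complex.normSq_eq_norm_sq]
    push_cast
    field_simp

lemma memLp_alignedPhase (d : ℕ) (s : ℝ) (z : Cd d) :
    MemLp (alignedPhase d s z) ∞ (ballMeasure d) := by
  refine memLp_top_of_bound (Measurable.aestronglyMeasurable ?_) 1
    (Eventually.of_forall (norm_alignedPhase_le d s z))
  have h := measurable_one_sub_inner_cpow z (-(s : ℂ))
  exact (Complex.continuous_conj.measurable.comp h).div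
    (Complex.measurable_ofReal.comp h.norm)

lemma eLpNorm_alignedPhase_le (d : ℕ) (s : ℝ) (z : Cd d) :
    eLpNorm (alignedPhase d s z) ∞ (ballMeasure d) ≤ 1 := by
  rw [eLpNorm_exponent_top, ← ENNReal.ofReal_one]
  exact eLpNormEssSup_le_of_ae_bound (Eventually.of_forall (norm_alignedPhase_le d s z))

/-- The monomial is Lipschitz with constant `n`, and `|w-ζ|` absorbs half a power of the kernel.
What remains is the kernel integral with `t = n - 1/2`, positive since `1 ≤ n`. -/
lemma norm_integral_kernel_sub_le {σ : ℝ} (hσ : -1 < σ) {d n : ℕ} (hd : 1 ≤ d) (hn : 1 ≤ n)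
    {ζ : Cd d} (hζ : ‖ζ‖ = 1) {r : ℝ} (hr0 : 0 ≤ r) (hr1 : r < 1) {α : Fin d → ℕ}
    (hα : α ∈ multiIndices d n) :
    ‖∫ w, ((1 / ‖1 - (inner ℂ w ((r : ℂ) • ζ) : ℂ)‖ ^ ((d : ℝ) + 1 + σ + n) : ℝ) : ℂ) *
        conj (monomials w α) ∂(bergmanMeasure d σ) -
      (hyperSum ((d : ℝ) + 1 + σ) n (r ^ 2) : ℂ) * conj (monomials ζ α)‖ ≤
      2 * n * (coeffLimit ((d : ℝ) + 1 + σ) (n - 1 / 2) / (1 - r ^ 2) ^ ((n : ℝ) - 1 / 2)) := by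
  have := isProbabilityMeasure_bergmanMeasure hσ hd
  have hl := parameter_pos hσ d
  set l := (d : ℝ) + 1 + σ with hl_def
  have hn1 : (1 : ℝ) ≤ n := by exact_mod_cast hn
  have hz : ‖(r : ℂ) • ζ‖ = r := by simp [norm_smul, hζ, abs_of_nonneg hr0]
  set z := (r : ℂ) • ζ
  have hz1 : ‖z‖ < 1 := hz ▸ hr1
  set k : Cd d → ℝ := fun w => 1 / ‖1 - (inner ℂ w z : ℂ)‖ ^ (l + n) with hk_def
  have hk : Integrable k (bergmanMeasure d σ) :=
    integrable_kernel_rpow hσ hd (by positivity) hz1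
  have hk2 := integrable_kernel_rpow hσ hd (s := l + (n - 1 / 2)) (by linarith) hz1
  have hkc : Integrable (fun w => (k w : ℂ) * conj (monomials w α)) (bergmanMeasure d σ) := by
    obtain ⟨hm, -⟩ := essBounded_conj_monomials d σ α
    refine hk.ofReal.mul_bdd (c := 1) hm ?_
    filter_upwards [ae_bergmanMeasure d σ] with w hw
    rw [RCLike.norm_conj]
    exact norm_monomials_le_one hw.le α
  have e1 : (hyperSum l n (r ^ 2) : ℂ) * conj (monomials ζ α) =
      ∫ w, (k w : ℂ) * conj (monomials ζ α) ∂(bergmanMeasure d σ) := by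
    rw [integral_mul_const, integral_complex_ofReal, hk_def,
      integral_kernel_rpow hσ hd (by linarith) hz1, hz]
  change ‖∫ w, (k w : ℂ) * conj (monomials w α) ∂(bergmanMeasure d σ) - _‖ ≤ _
  have hkz : Integrable (fun w => (k w : ℂ) * conj (monomials ζ α)) (bergmanMeasure d σ) :=
    hk.ofReal.mul_const _
  rw [e1, ← integral_sub hkc hkz]
  calc _ ≤ ∫ w, 2 * n * (1 / ‖1 - (inner ℂ w z : ℂ)‖ ^ (l + (n - 1 / 2)))
        ∂(bergmanMeasure d σ) := by
        refine norm_integral_le_of_norm_le (hk2.const_mul _) ?_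
        filter_upwards [ae_bergmanMeasure d σ] with w hw
        have hpos : 0 < ‖1 - (inner ℂ w z : ℂ)‖ := norm_pos_iff.2 (one_sub_inner_ne_zero hz1 hw)
        have hk0 : 0 ≤ k w := by simp only [hk_def]; positivity
        rw [← mul_sub, ← map_sub, norm_mul, RCLike.norm_conj, Complex.norm_real,
          Real.norm_of_nonneg hk0]
        calc k w * ‖monomials w α - monomials ζ α‖
            ≤ k w * (n * (2 * ‖1 - (inner ℂ w z : ℂ)‖ ^ (1 / 2 : ℝ))) := by
              have h1 := norm_monomials_sub_le hw.le hζ.le hα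
              have h2 := norm_sub_le_rpow_kernel hw hζ hr0 hr1
              refine mul_le_mul_of_nonneg_left (h1.trans ?_) hk0
              exact mul_le_mul_of_nonneg_left h2 (by positivity)
          _ = _ := by
              have e : ‖1 - (inner ℂ w z : ℂ)‖ ^ (l + n) =
                  ‖1 - (inner ℂ w z : ℂ)‖ ^ (l + (n - 1 / 2)) *
                    ‖1 - (inner ℂ w z : ℂ)‖ ^ (1 / 2 : ℝ) := by
                rw [← Real.rpow_add hpos]
                congr 1
                ring
              simp only [hk_def]
              rw [e]
              field_simp
    _ ≤ _ := by
        rw [integral_const_mul, integral_kernel_rpow hσ hd (by linarith) hz1, hz]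
        refine mul_le_mul_of_nonneg_left ?_ (by positivity)
        exact hyperSum_le hl (by linarith) (sq_nonneg r) (by nlinarith)

/-- After multiplication by `(1-r²)^n` the error of freezing `w` at `ζ` is `O((1-r²)^(1/2))`, while
the frozen term converges by the asymptotics of `hyperSum`. -/
lemma tendsto_integral_kernel {σ : ℝ} (hσ : -1 < σ) {d n : ℕ} (hd : 1 ≤ d) (hn : 1 ≤ n)
    {ζ : Cd d} (hζ : ‖ζ‖ = 1) {α : Fin d → ℕ} (hα : α ∈ multiIndices d n) :
    Tendsto (fun r : ℝ => ((1 - r ^ 2 : ℝ) : ℂ) ^ n *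
      ∫ w, ((1 / ‖1 - (inner ℂ w ((r : ℂ) • ζ) : ℂ)‖ ^ ((d : ℝ) + 1 + σ + n) : ℝ) : ℂ) *
        conj (monomials w α) ∂(bergmanMeasure d σ)) (𝓝[<] 1)
      (𝓝 ((coeffLimit ((d : ℝ) + 1 + σ) n : ℂ) * conj (monomials ζ α))) := by
  have hl := parameter_pos hσ d
  set l := (d : ℝ) + 1 + σ with hl_def
  have hn1 : (1 : ℝ) ≤ n := by exact_mod_cast hn
  have hev : ∀ᶠ r : ℝ in 𝓝[<] 1, 0 ≤ r ∧ r < 1 :=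
    Ico_mem_nhdsLT (show (0 : ℝ) < 1 by norm_num)
  have hsq : Tendsto (fun r : ℝ => r ^ 2) (𝓝[<] 1) (𝓝[<] 1) := by
    refine tendsto_nhdsWithin_iff.2 ⟨?_, hev.mono fun r hr => by
      simp only [mem_Iio]; nlinarith [hr.1, hr.2]⟩
    have : Tendsto (fun r : ℝ => r ^ 2) (𝓝 1) (𝓝 (1 ^ 2)) := (continuous_pow 2).tendsto 1
    rw [one_pow] at this
    exact this.mono_left nhdsWithin_le_nhds
  have h1 : Tendsto (fun r : ℝ => (((1 - r ^ 2) ^ n * hyperSum l n (r ^ 2) : ℝ) : ℂ) *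
      conj (monomials ζ α)) (𝓝[<] 1) (𝓝 ((coeffLimit l n : ℂ) * conj (monomials ζ α))) := by
    have h := (tendsto_one_sub_rpow_mul_hyperSum hl (show (0 : ℝ) < n by linarith)).comp hsq
    simp only [Function.comp_def, Real.rpow_natCast] at h
    exact ((Complex.continuous_ofReal.tendsto _).comp h).mul_const _
  have h2 : Tendsto (fun r : ℝ => 2 * n * coeffLimit l (n - 1 / 2) * (1 - r ^ 2) ^ (1 / 2 : ℝ))
      (𝓝[<] 1) (𝓝 0) := by
    have hc : ContinuousAt (fun r : ℝ => (1 - r ^ 2) ^ (1 / 2 : ℝ)) 1 :=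
      ContinuousAt.rpow_const (by fun_prop) (Or.inr (by norm_num))
    have h := (hc.tendsto.mono_left (nhdsWithin_le_nhds (s := Iio 1))).const_mul
      (2 * n * coeffLimit l (n - 1 / 2))
    simpa using h
  have h3 := squeeze_zero_norm' (f := fun r : ℝ => ((1 - r ^ 2 : ℝ) : ℂ) ^ n *
      (∫ w, ((1 / ‖1 - (inner ℂ w ((r : ℂ) • ζ) : ℂ)‖ ^ (l + n) : ℝ) : ℂ) *
        conj (monomials w α) ∂(bergmanMeasure d σ)) -
      (((1 - r ^ 2) ^ n * hyperSum l n (r ^ 2) : ℝ) : ℂ) * conj (monomials ζ α)) ?_ h2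
  · have := h3.add h1
    simpa using this
  · filter_upwards [hev] with r hr
    have hpos : 0 < 1 - r ^ 2 := by nlinarith [hr.1, hr.2]
    have h := norm_integral_kernel_sub_le hσ hd hn hζ hr.1 hr.2 hα
    have e : (1 - r ^ 2) ^ n = (1 - r ^ 2) ^ ((n : ℝ) - 1 / 2) * (1 - r ^ 2) ^ (1 / 2 : ℝ) := by
      rw [← Real.rpow_add hpos, ← Real.rpow_natCast]
      congr 1
      ring
    push_cast [mul_assoc]
    rw [← mul_sub, norm_mul, norm_pow]
    rw [show (1 - (r : ℂ) ^ 2) = ((1 - r ^ 2 : ℝ) : ℂ) by push_cast; ring, Complex.norm_real,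
      Real.norm_of_nonneg hpos.le]
    have hp2 : 0 < (1 - r ^ 2) ^ ((n : ℝ) - 1 / 2) := Real.rpow_pos_of_pos hpos _
    calc _ ≤ (1 - r ^ 2) ^ n *
          (2 * n * (coeffLimit l (n - 1 / 2) / (1 - r ^ 2) ^ ((n : ℝ) - 1 / 2))) := by
          refine mul_le_mul_of_nonneg_left ?_ (by positivity)
          convert! h using 4
          push_cast
          rfl
      _ = _ := by
          rw [e]
          field_simp

lemma le_bergmanOpNorm {σ : ℝ} (hσ : -1 < σ) {d n : ℕ} (hd : 1 ≤ d) (hn : 1 ≤ n) {p : ℝ}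
    (hp : 1 ≤ p) {ζ : Cd d} (hζ : ‖ζ‖ = 1) :
    ENNReal.ofReal (ellp d n p (monomials ζ) *
      (rising ((d : ℝ) + 1 + σ) n * coeffLimit ((d : ℝ) + 1 + σ) n)) ≤ bergmanOpNorm d n p σ := by
  have hl := parameter_pos hσ d
  set l := (d : ℝ) + 1 + σ with hl_def
  have hn0 : (0 : ℝ) < n := by exact_mod_cast hn
  have hrise := rising_pos hl n
  have hL := coeffLimit_pos hl hn0
  let I : ℝ → (Fin d → ℕ) → ℂ := fun r α => ((1 - r ^ 2 : ℝ) : ℂ) ^ n *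
    ∫ w, ((1 / ‖1 - (inner ℂ w ((r : ℂ) • ζ) : ℂ)‖ ^ (l + n) : ℝ) : ℂ) *
        conj (monomials w α) ∂(bergmanMeasure d σ)
  have hlim : Tendsto (fun r => rising l n * ellp d n p (I r)) (𝓝[<] 1)
      (𝓝 (rising l n * ellp d n p (fun α => (coeffLimit l n : ℂ) * conj (monomials ζ α)))) := by
    refine Tendsto.const_mul _ (Tendsto.rpow_const ?_ (Or.inr (by positivity)))
    refine tendsto_finsetSum _ fun α hα => Tendsto.rpow_const ?_ (Or.inr (by linarith))
    exact (tendsto_integral_kernel hσ hd hn hζ hα).norm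
  have e1 : rising l n * ellp d n p (fun α => (coeffLimit l n : ℂ) * conj (monomials ζ α)) =
      ellp d n p (monomials ζ) * (rising l n * coeffLimit l n) := by
    rw [ellp_mul_left hp, Complex.norm_real, Real.norm_of_nonneg hL.le,
      ellp_congr (W := monomials ζ) fun α _ => RCLike.norm_conj _]
    ring
  rw [e1] at hlim
  refine le_of_tendsto (ENNReal.tendsto_ofReal hlim) ?_
  filter_upwards [Ico_mem_nhdsLT (show (0 : ℝ) < 1 by norm_num)] with r hr
  have hz : ‖(r : ℂ) • ζ‖ = r := by simp [norm_smul, hζ, abs_of_nonneg hr.1]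
  have hz1 : (r : ℂ) • ζ ∈ unitBall d := by
    rw [mem_ball_zero_iff, hz]
    exact hr.2
  have hpos : 0 < 1 - r ^ 2 := by nlinarith [hr.1, hr.2]
  -- The test function varies with `r`. This is harmless because the operator norm dominates the
  -- value for each `r` separately, before the limit is taken.
  let G := alignedPhase d (l + n) ((r : ℂ) • ζ)
  have hG := memLp_alignedPhase d (l + n) ((r : ℂ) • ζ)
  have e2 : rising l n * ellp d n p (I r) = (1 - ‖(r : ℂ) • ζ‖ ^ 2) ^ n *
      ellp d n p (fun α => mixedPartial α (bergmanProj d σ G) ((r : ℂ) • ζ)) := by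
    have e3 : ∀ α ∈ multiIndices d n, mixedPartial α (bergmanProj d σ G) ((r : ℂ) • ζ) =
        rising l n * ∫ w, ((1 / ‖1 - (inner ℂ w ((r : ℂ) • ζ) : ℂ)‖ ^ (l + n) : ℝ) : ℂ) *
          conj (monomials w α) ∂(bergmanMeasure d σ) := by
      intro α hα
      rw [mixedPartial_bergmanProj hσ hd (essBounded_of_memLp σ hG) hα hz1, ← integral_const_mul]
      refine integral_congr_ae (Eventually.of_forall fun w => ?_)
      simp only []
      rw [← mul_alignedPhase]
      ring
    rw [hz, ellp_congr fun α hα => congrArg norm (e3 α hα), ellp_mul_left hp, ellp_mul_left hp,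
      norm_pow, Complex.norm_real, Complex.norm_real, Real.norm_of_nonneg hpos.le,
      Real.norm_of_nonneg hrise.le]
    ring
  rw [e2]
  refine le_trans ?_ (le_iSup₂_of_le (α := ℝ≥0∞) G hG (le_iSup_of_le
    (eLpNorm_alignedPhase_le d (l + n) ((r : ℂ) • ζ)) le_rfl))
  exact le_iSup₂_of_le (α := ℝ≥0∞) ((r : ℂ) • ζ) hz1 le_rfl

lemma bergmanOpNorm_eq {σ : ℝ} (hσ : -1 < σ) {d n : ℕ} (hd : 1 ≤ d) (hn : 1 ≤ n) {p : ℝ}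
    (hp : 1 ≤ p) {C : ℝ}
    (hC : IsGreatest ((fun ζ : Cd d => ellp d n p (monomials ζ)) '' Metric.sphere 0 1) C) :
    bergmanOpNorm d n p σ =
      ENNReal.ofReal (C * (Real.Gamma (((d : ℝ) + 1 + σ) + n) * Real.Gamma n /
        Real.Gamma ((((d : ℝ) + 1 + σ) + n) / 2) ^ 2)) := by
  rw [← rising_mul_coeffLimit (parameter_pos hσ d)]
  refine le_antisymm (bergmanOpNorm_le hσ hd hn hp hC) ?_
  obtain ⟨ζ, hζ, rfl⟩ := hC.1
  exact le_bergmanOpNorm hσ hd hn hp (by simpa using hζ)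

end

end BergmanBloch

end

theorem mainTheorem2 (d n : ℕ) (hd : 1 ≤ d) (hn : 1 ≤ n) (p : ℝ) (hp : 1 ≤ p) :
    ∃ C : ℝ,
      IsGreatest ((fun ζ : BergmanBloch.Cd d =>
        BergmanBloch.ellp d n p (BergmanBloch.monomials ζ)) '' Metric.sphere 0 1) C ∧
      (∀ σ : ℝ, -1 < σ →
        (∀ G : BergmanBloch.Cd d → ℂ, MemLp G ∞ (BergmanBloch.ballMeasure d) →
          (∀ z ∈ BergmanBloch.unitBall d,
            Integrable (fun w => BergmanBloch.bergmanKernel d σ z w * G w)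
              (BergmanBloch.ballMeasure d)) ∧
          BergmanBloch.MemBloch d (BergmanBloch.bergmanProj d σ G)) ∧
        BergmanBloch.bergmanOpNorm d n p σ =
          ENNReal.ofReal (C * (Real.Gamma (((d : ℝ) + 1 + σ) + n) * Real.Gamma n /
            Real.Gamma ((((d : ℝ) + 1 + σ) + n) / 2) ^ 2))) ∧
      (2 ≤ p → C = 1) ∧
      (p < 2 →
        (((n + d - 1).choose (d - 1) : ℕ) : ℝ) ^ (1 / p) * (d : ℝ) ^ (-(n : ℝ) / 2) ≤ C ∧
        C ≤ (((n + d - 1).choose (d - 1) : ℕ) : ℝ) ^ (1 / p - 1 / 2)) ∧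
      (n = 1 → p < 2 → C = (d : ℝ) ^ (1 / p - 1 / 2)) := by
  obtain ⟨C, hC⟩ := BergmanBloch.exists_isGreatest_ellp_monomials hd n hp
  refine ⟨C, hC, fun σ hσ => ⟨fun G hG => ?_, BergmanBloch.bergmanOpNorm_eq hσ hd hn hp hC⟩,
    fun h => BergmanBloch.isGreatest_eq_one_of_two_le hd h hC,
    fun h => ⟨BergmanBloch.le_isGreatest hd hp hC,
      BergmanBloch.isGreatest_le_of_lt_two hd hp h hC⟩,
    fun h1 h2 => BergmanBloch.isGreatest_eq_of_order_one hd hp h1 h2 hC⟩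
  have hb := BergmanBloch.essBounded_of_memLp σ hG
  exact ⟨fun z hz => BergmanBloch.integrable_bergmanKernel_mul hσ hd hb (by simpa using hz),
    BergmanBloch.memBloch_bergmanProj hσ hd hb⟩
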